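/- Let $X=(X_1,\dots,X_m)$ be an $m$-tuple of linearly independent smooth vector fields on $\mathbb R^n$, $X_i=\sum_{j}a_{ij}\partial_{x_j}$. For an open set $\Omega\subset\mathbb R^n$ and $\varphi\in C^1_c(\Omega;\mathbb R^m)$ put $\operatorname{div}_X\varphi:=\sum_{i=1}^m\sum_{j=1}^n\partial_{x_j}(a_{ij}\varphi_i)$. A function $u\in L^1(\Omega)$ belongs to $BV_H(\Omega)$ if there is an $\mathbb R^m$-valued Radon measure $D_Hu=(D_{X_1}u,\dots,D_{X_m}u)$ on $\Omega$ with finite total variation such that $$\int_\Omega\varphi\cdot d D_Hu=-\int_\Omega u\,\operatorname{div}_X\varphi\,d\mathscr L^n\qquad\text{for all }\varphi\in C^1_c(\Omega;\mathbb R^m).$$ A set $E\subset\Omega$ has finite $H$-perimeter in $\Omega$ if $\chi_E\in L^1_{loc}(\Omega)$ and there is a measure $D_H\chi_E$ with the same properties for $\chi_E$ in place of $u$. On $\mathbb R^{n+1}=\mathbb R^n\times\mathbb R$ consider the family $\widetilde X=(\widetilde X_1,\dots,\widetilde X_{m+1})$ with $\widetilde X_i(x,t)=(X_i(x),0)$ for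 $i\le m$ and $\widetilde X_{m+1}=\partial_t$; the corresponding notions on open subsets of $\mathbb R^{n+1}$ are defined in the same way, with $D_{\widetilde H}=(D_{\widetilde X_1},\dots,D_{\widetilde X_m},\partial_t)$ and $D'_{\widetilde H}=(D_{\widetilde X_1},\dots,D_{\widetilde X_m})$. Let $\pi(x,t)=x$, and let $|\mu|$ denote the total variation of a vector measure $\mu$ with respect to the Euclidean norm. Theorem. Let $\Omega\subset\mathbb R^n$ be open and bounded, let $u\in L^1(\Omega)$, and let $E_u=\{(x,t)\in\Omega\times\mathbb R: t<u(x)\}$. Then $u\in BV_H(\Omega)$ if and only if $E_u$ has finite $H$-perimeter in $\Omega\times\mathbb R$ with respect to $\widetilde X$. Moreover, in this case the following identities of measures on $\Omega$ hold: (i) $\pi_\# D_{\widetilde X_i}\chi_{E_u}=D_{X_i}u$ for $i=1,\dots,m$; (ii) $\pi_\#\,\partial_t\chi_{E_u}=-\mathscr L^n$; (iii) $\pi_\#|D_{\widetilde X_i}\chi_{E_u}|=|D_{X_i}u|$ for $i=1,\dots,m$; (iv) $\pi_\#|\partial_t\chi_{E_u}|=\mathscr L^n$; (v) $\pi_\#|D'_{\widetilde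 H}\chi_{E_u}|=|D_Hu|$; (vi) $\pi_\#|D_{\widetilde H}\chi_{E_u}|=|(D_Hu,-\mathscr L^n)|$. -/

import Mathlib

open MeasureTheory Set
open scoped ContDiff

noncomputable section

namespace HVar

section General

variable {E : Type*} [NormedAddCommGroup E] [NormedSpace ℝ E] {ι : Type*}

/-- The divergence `∑ⱼ ∂ⱼ Vⱼ` of a vector field `V`, i.e. the trace of its derivative. -/
def divergence (V : E → E) (x : E) : ℝ :=
  LinearMap.trace ℝ E (fderiv ℝ V x).toLinearMap

/-- `div_X φ = ∑ᵢ div (φᵢ Xᵢ) = ∑ᵢ ∑ⱼ ∂ⱼ (aᵢⱼ φᵢ)`, where `Xᵢ = ∑ⱼ aᵢⱼ ∂ⱼ`. -/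
def divX [Fintype ι] (X : ι → E → E) (φ : E → EuclideanSpace ℝ ι) (x : E) : ℝ :=
  ∑ i, divergence (fun y => φ y i • X i y) x

/-- The `ℝ^ι`-valued measure `(μᵢ)ᵢ` with components `μᵢ`; `ℝ^ι` carries the Euclidean norm. -/
def ofComponents {α : Type*} [MeasurableSpace α] (μ : ι → SignedMeasure α) :
    VectorMeasure α (EuclideanSpace ℝ ι) where
  measureOf' A := WithLp.toLp 2 fun i => μ i A
  empty' := by ext i; simp
  not_measurable' A hA := by ext i; simp [hA]
  m_iUnion' f hf hd := by
    have h : HasSum (fun k i => μ i (f k)) (fun i => μ i (⋃ k, f k)) :=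
      Pi.hasSum.2 fun i => (μ i).m_iUnion hf hd
    exact h.map (WithLp.linearEquiv 2 ℝ (ι → ℝ)).symm (PiLp.continuous_toLp 2 _)

/-- The total variation `|(μᵢ)ᵢ|` of the vector measure `(μᵢ)ᵢ`, a positive measure:
the supremum of `∑ ‖μ (Bₗ)‖` over partitions, with the Euclidean norm. -/
def totalVar [Fintype ι] {α : Type*} [MeasurableSpace α] (μ : ι → SignedMeasure α) :
    Measure α :=
  (ofComponents μ).variation

variable [MeasureSpace E] [Fintype ι]

/-- The finite vector measure `D = (Dᵢ)ᵢ` on the open set `Ω` is the distributional horizontal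
derivative `(D_{X₁} u, …, D_{Xₘ} u)` of `u` in `Ω`. A measure on `Ω` is regarded as a measure on
the whole space which vanishes off `Ω`. -/
structure IsHDeriv (X : ι → E → E) (Ω : Set E) (u : E → ℝ) (D : ι → SignedMeasure E) :
    Prop where
  concentrated : ∀ i A, MeasurableSet A → Disjoint A Ω → D i A = 0
  finite_variation : totalVar D univ < ⊤
  integral_eq : ∀ φ : E → EuclideanSpace ℝ ι,
    ContDiff ℝ 1 φ → HasCompactSupport φ → tsupport φ ⊆ Ω →
      ∑ i, ∫ᵛ x, φ x i ∂•(D i) = -∫ x in Ω, u x * divX X φ x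

/-- `u ∈ BV_H(Ω)`: `u` is integrable on `Ω` and has a horizontal derivative that is a vector
measure with finite total variation on `Ω`. -/
def MemBVH (X : ι → E → E) (Ω : Set E) (u : E → ℝ) : Prop :=
  IntegrableOn u Ω ∧ ∃ D : ι → SignedMeasure E, IsHDeriv X Ω u D

/-- `S ⊆ Ω` has finite `H`-perimeter in `Ω`: its characteristic function, a locally integrable
function, has a horizontal derivative that is a vector measure with finite total variation
on `Ω`. (The Lebesgue measure of `S` may be infinite.) -/
def HasFiniteHPerimeter (X : ι → E → E) (Ω S : Set E) : Prop :=
  S ⊆ Ω ∧ LocallyIntegrableOn (S.indicator fun _ => (1 : ℝ)) Ω ∧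
    ∃ D : ι → SignedMeasure E, IsHDeriv X Ω (S.indicator fun _ => (1 : ℝ)) D

end General

variable {n m : ℕ}

/-- The family `(X₁, …, Xₘ, ∂ₜ)` on `ℝⁿ × ℝ`. -/
def extend (X : Fin m → EuclideanSpace ℝ (Fin n) → EuclideanSpace ℝ (Fin n)) :
    Fin (m + 1) → EuclideanSpace ℝ (Fin n) × ℝ → EuclideanSpace ℝ (Fin n) × ℝ :=
  Fin.snoc (α := fun _ => EuclideanSpace ℝ (Fin n) × ℝ → EuclideanSpace ℝ (Fin n) × ℝ)
    (fun i p => (X i p.1, 0)) (fun _ => (0, 1))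

/-- The subgraph `{(x, t) ∈ Ω × ℝ : t < u x}`. -/
def subgraph (Ω : Set (EuclideanSpace ℝ (Fin n))) (u : EuclideanSpace ℝ (Fin n) → ℝ) :
    Set (EuclideanSpace ℝ (Fin n) × ℝ) :=
  {p | p.1 ∈ Ω ∧ p.2 < u p.1}

/-- Lebesgue measure on the bounded set `Ω`, as a signed measure. -/
def lebesgueSigned (Ω : Set (EuclideanSpace ℝ (Fin n))) (hΩ : Bornology.IsBounded Ω) :
    SignedMeasure (EuclideanSpace ℝ (Fin n)) :=
  haveI : IsFiniteMeasure (volume.restrict Ω) :=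
    ⟨by simpa using hΩ.measure_lt_top⟩
  (volume.restrict Ω).toSignedMeasure

/-- The vector measure `(D, -𝓛ⁿ)` on `Ω`. -/
def appendNegLebesgue (Ω : Set (EuclideanSpace ℝ (Fin n))) (hΩ : Bornology.IsBounded Ω)
    (D : Fin m → SignedMeasure (EuclideanSpace ℝ (Fin n))) :
    Fin (m + 1) → SignedMeasure (EuclideanSpace ℝ (Fin n)) :=
  Fin.snoc (α := fun _ => SignedMeasure (EuclideanSpace ℝ (Fin n))) D (-lebesgueSigned Ω hΩ)

end HVar

end

noncomputable section

open Filter Topology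
open scoped ENNReal NNReal

namespace HVar

/-! ### Integration against signed and vector measures, and their total variation. -/

section SignedMeasures

variable {α : Type*} [MeasurableSpace α]

/-! For a `C¹` function `v` the distributional derivative of `χ_{E_v}` along `(X, 0)` is the measure
`Xv dx` carried by the graph of `v`: this is `integral_Iio_divergence_eq`. Apply it to the
mollifications `u_k = u * ρ_k`. Friedrichs' lemma says that `X u_k - (D_X u) * ρ_k` tends to `0` in
`L¹` on compact subsets of `Ω`. Since `v ↦ ∫∫_{t < v} G` is continuous in `L¹`, the derivative of
`χ_{E_u}`, tested against `φ`, is the limit of `∫ φ(x, u_k(x)) ((D_X u) * ρ_k)(x) dx`, that is, of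
the integrals against `D_X u` of the averages `graphAvg u k φ` (`tendsto_integral_graphAvg`). The
vertical derivative has the same form, with `-𝓛ⁿ` in place of `D_X u`.

The operators `graphAvg u k` are positive and average `φ` with a probability density. Hence a weak
limit exists as a finite measure, which gives finite perimeter when `u ∈ BV_H`. Moreover they do not
increase the Euclidean sup norm of a vector field, and the same operator serves every component. By
duality the mass of any subfamily of components of the derivative of `χ_{E_u}` is at most that of
the corresponding subfamily of `(D_H u, -𝓛ⁿ)` (`totalVar_univ_le_of_tendsto_graphAvg`).

Conversely, testing the derivative of `χ_{E_u}` with `ψ(x) η_k(t)`, `η_k ↑ 1` in effect, identifies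
its projection as `D_X u`, respectively `-𝓛ⁿ`. This gives the converse implication and (i), (ii). A
projection cannot increase variation, so `|D| ≤ π_# |Dχ|`; the mass bound is the opposite inequality
for total masses, and ordered finite measures of equal mass coincide. Choosing one component, the
first `m`, or all of them gives (iii)–(vi). -/

lemma isFiniteMeasure_variation (μ : SignedMeasure α) : IsFiniteMeasure μ.variation := by
  rw [← SignedMeasure.totalVariation_eq_variation]
  unfold SignedMeasure.totalVariation
  infer_instance

attribute [local instance] isFiniteMeasure_variation

/-- Reduces integrals against a signed measure to ordinary ones, so that Fubini's theorem and limits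
of positive functionals can be applied to the two Jordan parts. -/
lemma integral_signedMeasure_eq_sub (μ : SignedMeasure α) {f : α → ℝ}
    (hf : Integrable f μ.variation) :
    ∫ᵛ x, f x ∂•μ = ∫ x, f x ∂μ.toJordanDecomposition.posPart -
      ∫ x, f x ∂μ.toJordanDecomposition.negPart := by
  -- Multiplication on `ℝ` is symmetric; the flipped pairing is the one for which integration
  -- against `toSignedMeasure` is the Bochner integral.
  have hB : (ContinuousLinearMap.lsmul ℝ ℝ : ℝ →L[ℝ] ℝ →L[ℝ] ℝ) =
      (ContinuousLinearMap.lsmul ℝ ℝ : ℝ →L[ℝ] ℝ →L[ℝ] ℝ).flip := by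
    ext; simp
  have hμ : μ = μ.toJordanDecomposition.posPart.toSignedMeasure -
      μ.toJordanDecomposition.negPart.toSignedMeasure :=
    (SignedMeasure.toSignedMeasure_toJordanDecomposition μ).symm
  rw [← SignedMeasure.totalVariation_eq_variation, SignedMeasure.totalVariation,
    integrable_add_measure] at hf
  conv_lhs => rw [hμ, hB]
  rw [VectorMeasure.integral_sub_vectorMeasure (by simpa [VectorMeasure.Integrable] using hf.1)
    (by simpa [VectorMeasure.Integrable] using hf.2), VectorMeasure.integral_toSignedMeasure,
    VectorMeasure.integral_toSignedMeasure]

lemma integral_toSignedMeasure_lsmul (μ : Measure α) [IsFiniteMeasure μ] (f : α → ℝ) :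
    ∫ᵛ x, f x ∂•μ.toSignedMeasure = ∫ x, f x ∂μ := by
  have hB : (ContinuousLinearMap.lsmul ℝ ℝ : ℝ →L[ℝ] ℝ →L[ℝ] ℝ) =
      (ContinuousLinearMap.lsmul ℝ ℝ : ℝ →L[ℝ] ℝ →L[ℝ] ℝ).flip := by
    ext; simp
  rw [hB, VectorMeasure.integral_toSignedMeasure]

variable {ι : Type*}

@[simp]
lemma ofComponents_apply (μ : ι → SignedMeasure α) (A : Set α) (i : ι) :
    ofComponents μ A i = μ i A := rfl

variable [Fintype ι]

lemma variation_le_totalVar (μ : ι → SignedMeasure α) (i : ι) :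
    (μ i).variation ≤ totalVar μ := by
  refine VectorMeasure.variation_le_of_forall_enorm_le fun A _ => ?_
  refine le_trans ?_ (VectorMeasure.enorm_measure_le_variation (ofComponents μ) A)
  rw [enorm_le_iff_norm_le, ← ofComponents_apply μ A i]
  exact PiLp.norm_apply_le _ _

lemma totalVar_le_sum (μ : ι → SignedMeasure α) :
    totalVar μ ≤ ∑ i, (μ i).variation := by
  classical
  refine VectorMeasure.variation_le_of_forall_enorm_le fun A _ => ?_
  have h : ofComponents μ A = ∑ i, EuclideanSpace.single i (μ i A) := by
    ext j
    simp
  rw [h, Measure.finsetSum_apply]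
  refine (enorm_sum_le _ _).trans (Finset.sum_le_sum fun i _ => ?_)
  refine le_trans (le_of_eq ?_) (VectorMeasure.enorm_measure_le_variation (μ i) A)
  rw [← ofReal_norm, ← ofReal_norm, PiLp.norm_single]

instance isFiniteMeasure_totalVar (μ : ι → SignedMeasure α) : IsFiniteMeasure (totalVar μ) :=
  isFiniteMeasure_of_le _ (totalVar_le_sum μ)

lemma totalVar_unique [Unique ι] (μ : ι → SignedMeasure α) :
    totalVar μ = (μ default).variation := by
  refine le_antisymm ((totalVar_le_sum μ).trans ?_) (variation_le_totalVar μ default)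
  simp

lemma totalVar_eq_zero {μ : ι → SignedMeasure α} (h : totalVar μ = 0) (i : ι) : μ i = 0 := by
  rw [← VectorMeasure.variation_eq_zero]
  exact le_antisymm (h ▸ variation_le_totalVar μ i) (Measure.zero_le _)

lemma totalVar_map_le {β : Type*} [MeasurableSpace β] {g : α → β} (hg : Measurable g)
    (μ : ι → SignedMeasure α) :
    totalVar (fun i => (μ i).map g) ≤ (totalVar μ).map g := by
  have h : ofComponents (fun i => (μ i).map g) = (ofComponents μ).map g := by
    ext A hA i
    simp [VectorMeasure.map_apply _ hg hA]
  rw [totalVar, h]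
  exact VectorMeasure.variation_map_le

/-- The integral of an `ℝ^ι`-valued function against `(μᵢ)ᵢ`, paired by the inner product. -/
lemma integral_inner_ofComponents (μ : ι → SignedMeasure α) {f : α → EuclideanSpace ℝ ι}
    (hf : Integrable f (totalVar μ)) :
    ∫ᵛ x, f x ∂[innerSL ℝ; ofComponents μ] = ∑ i, ∫ᵛ x, f x i ∂•(μ i) := by
  classical
  have hfi : ∀ i, Integrable (fun x => f x i) (totalVar μ) := fun i =>
    (EuclideanSpace.proj (𝕜 := ℝ) i : EuclideanSpace ℝ ι →L[ℝ] ℝ).integrable_comp hf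
  let e : ι → EuclideanSpace ℝ ι := fun i => EuclideanSpace.single i (1 : ℝ)
  let C : ι → ℝ →L[ℝ] EuclideanSpace ℝ ι := fun i => ContinuousLinearMap.toSpanSingleton ℝ (e i)
  have hsum : ∀ x, f x = ∑ i, C i (f x i) := fun x => by
    ext j
    simp [C, e, ContinuousLinearMap.toSpanSingleton_apply, Pi.single_apply]
  have h1 : ∫ᵛ x, f x ∂[innerSL ℝ; ofComponents μ] =
      ∫ᵛ x, ∑ i, C i (f x i) ∂[innerSL ℝ; ofComponents μ] := by
    congr 1
    funext x
    exact hsum x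
  rw [h1, VectorMeasure.integral_finsetSum _ fun i _ => (C i).integrable_comp (hfi i)]
  refine Finset.sum_congr rfl fun i _ => ?_
  rw [VectorMeasure.integral_continuousLinearMap_comp (hfi i),
    VectorMeasure.integral_eq_setToFun_transpose (hfi i),
    VectorMeasure.integral_eq_setToFun_transpose ((hfi i).mono_measure (variation_le_totalVar μ i))]
  -- Pairing with the `i`-th basis vector extracts the `i`-th component of the measure.
  have hT : (ofComponents μ).transpose (innerSL ℝ ∘L C i) =
      (μ i).transpose (ContinuousLinearMap.lsmul ℝ ℝ) := by
    ext A hA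
    simp only [transpose_eq_cbmApplyMeasure, cbmApplyMeasure_apply, C, e,
      ContinuousLinearMap.comp_apply, ContinuousLinearMap.toSpanSingleton_apply, one_smul]
    refine (innerSL_apply_apply ℝ _ _).trans ?_
    simp [EuclideanSpace.inner_single_left]
  simp only [hT]

/-- The sum is one integral for the inner product pairing, whose norm is at most `1`. Estimating
component by component would lose the sharp constant on which equality of the masses depends. -/
lemma abs_sum_integral_le (μ : ι → SignedMeasure α) {f : α → EuclideanSpace ℝ ι}
    (hf : AEStronglyMeasurable f (totalVar μ)) {C : ℝ} (hC : ∀ x, ‖f x‖ ≤ C) :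
    |∑ i, ∫ᵛ x, f x i ∂•(μ i)| ≤ C * (totalVar μ).real univ := by
  have hint : Integrable f (totalVar μ) := Integrable.of_bound hf C (Eventually.of_forall hC)
  have : IsFiniteMeasure (ofComponents μ).variation := isFiniteMeasure_totalVar μ
  -- On an empty space nothing forces `C` to be nonnegative.
  rcases isEmpty_or_nonempty α with hα | ⟨⟨x₀⟩⟩
  · simp [VectorMeasure.integral_of_isEmpty, measureReal_def, univ_eq_empty_iff.2 hα]
  have hC0 : 0 ≤ C := (norm_nonneg _).trans (hC x₀)
  rw [← integral_inner_ofComponents μ hint, ← Real.norm_eq_abs]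
  refine (VectorMeasure.norm_integral_le_of_norm_le_const (Eventually.of_forall hC)).trans ?_
  have h1 : ‖(innerSL ℝ : EuclideanSpace ℝ ι →L[ℝ] _)‖ ≤ 1 := norm_innerSL_le ℝ
  have h2 : 0 ≤ (totalVar μ).real univ := measureReal_nonneg
  calc C * ‖(innerSL ℝ : EuclideanSpace ℝ ι →L[ℝ] _)‖ * (totalVar μ).real univ
      ≤ C * 1 * (totalVar μ).real univ := by gcongr
    _ = _ := by ring

end SignedMeasures

attribute [local instance] isFiniteMeasure_variation

/-! ### Total variation by duality with `C¹` test fields. -/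

section Duality

/-- Take the open Voronoi cells: the points strictly closer to `K i` than to every other `K j`. They
are open because the family is finite. -/
lemma exists_pairwise_disjoint_open {α κ : Type*} [PseudoEMetricSpace α] [Finite κ]
    {K : κ → Set α} (hK : ∀ i, IsClosed (K i)) (hd : Pairwise fun i j => Disjoint (K i) (K j)) :
    ∃ U : κ → Set α, (∀ i, IsOpen (U i)) ∧ (∀ i, K i ⊆ U i) ∧
      Pairwise fun i j => Disjoint (U i) (U j) := by
  refine ⟨fun i => ⋂ j ∈ {j | j ≠ i}, {x | Metric.infEDist x (K i) < Metric.infEDist x (K j)},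
    fun i => ?_, fun i x hx => ?_, fun i j hij => ?_⟩
  · exact (Set.toFinite _).isOpen_biInter fun j _ =>
      isOpen_lt Metric.continuous_infEDist Metric.continuous_infEDist
  · simp only [mem_iInter, mem_ofPred_eq]
    intro j hj
    rw [Metric.infEDist_zero_of_mem hx, pos_iff_ne_zero]
    intro h0
    have : x ∈ K j := by
      rw [← (hK j).closure_eq]
      exact Metric.mem_closure_iff_infEDist_zero.2 h0
    exact disjoint_left.1 (hd hj) this hx
  · refine disjoint_left.2 fun x hxi hxj => ?_
    simp only [mem_iInter, mem_ofPred_eq] at hxi hxj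
    exact lt_asymm (hxi j hij.symm) (hxj i hij)

variable {E : Type*} [NormedAddCommGroup E] [NormedSpace ℝ E] [FiniteDimensional ℝ E]

lemma exists_smooth_bump {K U : Set E} (hK : IsCompact K) (hU : IsOpen U) (hKU : K ⊆ U) :
    ∃ χ : E → ℝ, ContDiff ℝ ∞ χ ∧ HasCompactSupport χ ∧ tsupport χ ⊆ U ∧
      (∀ x, χ x ∈ Icc (0 : ℝ) 1) ∧ ∀ x ∈ K, χ x = 1 := by
  obtain ⟨L, hL, hKL, hLU⟩ := exists_compact_between hK hU hKU
  obtain ⟨f, hf1, hf0, hf⟩ := exists_contMDiffMap_one_nhds_of_subset_interior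
    (n := (⊤ : ℕ∞)) (modelWithCornersSelf ℝ E) hK.isClosed hKL
  have hsupp : tsupport f ⊆ L := closure_minimal
    (fun x hx => by_contra fun h => hx (hf0 x h)) hL.isClosed
  exact ⟨f, f.contMDiff.contDiff, hL.of_isClosed_subset (isClosed_tsupport _) hsupp,
    hsupp.trans hLU, hf, fun x hx => (hf1.self_of_nhdsSet) x hx⟩

variable [MeasurableSpace E] [BorelSpace E] {ι : Type*} [Fintype ι]

/-- On a nearly optimal finite partition the best test field points in the direction of `μ p` on
each piece `p`. Inner and outer regularity replace the pieces by compact sets with disjoint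
neighbourhoods, where smooth bumps realize this field up to a small error. -/
lemma totalVar_univ_le_of_forall_integral_le {Ω : Set E} (hΩ : IsOpen Ω)
    {μ : ι → SignedMeasure E}
    (hμ : ∀ i A, MeasurableSet A → Disjoint A Ω → μ i A = 0) {C : ℝ}
    (h : ∀ φ : E → EuclideanSpace ℝ ι, ContDiff ℝ 1 φ → HasCompactSupport φ → tsupport φ ⊆ Ω →
      (∀ x, ‖φ x‖ ≤ 1) → ∑ i, ∫ᵛ x, φ x i ∂•(μ i) ≤ C) :
    totalVar μ univ ≤ ENNReal.ofReal C := by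
  classical
  have : ProperSpace E := FiniteDimensional.proper ℝ E
  have hfin : IsFiniteMeasure (totalVar μ) := inferInstance
  have hfin' : IsFiniteMeasure (ofComponents μ).variation := hfin
  -- it suffices to bound the sums over partitions
  refine ENNReal.le_of_forall_pos_le_add fun ε hε _ => ?_
  obtain ⟨P, -, hPd, hPm, hP⟩ := VectorMeasure.exists_variation_le_add (ofComponents μ)
    MeasurableSet.univ (half_pos hε) (measure_ne_top _ _)
  have hΩ0 : totalVar μ Ωᶜ = 0 := by
    refine (VectorMeasure.variation_apply_eq_zero hΩ.measurableSet.compl).2 fun t ht htm => ?_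
    ext i
    exact hμ i t htm (disjoint_left.2 fun x hx => ht hx)
  -- Each piece costs `2δ`: once for the part lost outside `K p`, once for the tail of the bump
  -- around `K p`. The other `ε / 2` is spent on the partition.
  obtain ⟨δ, hδ, hδP⟩ : ∃ δ : ℝ≥0, 0 < δ ∧ (2 * P.card * δ : ℝ≥0) ≤ ε / 2 := by
    refine ⟨ε / 2 / (2 * P.card + 1), by positivity, ?_⟩
    rw [mul_div_assoc', div_le_iff₀ (by positivity)]
    nlinarith [hε]
  have hδ' : (δ : ℝ≥0∞) ≠ 0 := by exact_mod_cast hδ.ne'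
  -- compact subsets
  have hK : ∀ p : P, ∃ K ⊆ (p : Set E) ∩ Ω, IsCompact K ∧
      totalVar μ (((p : Set E) ∩ Ω) \ K) < δ := fun p =>
    ((hPm p p.2).inter hΩ.measurableSet).exists_isCompact_sdiff_lt (measure_ne_top _ _) hδ'
  choose K hKs hKc hKδ using hK
  have hKd : Pairwise fun p q : P => Disjoint (K p) (K q) := fun p q hpq =>
    (hPd p.2 q.2 (fun h => hpq (Subtype.ext h))).mono
      ((hKs p).trans inter_subset_left) ((hKs q).trans inter_subset_left)
  -- Disjointness keeps the norm of the sum of the bumps at most `1`.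
  obtain ⟨U₁, hU₁o, hU₁K, hU₁d⟩ := exists_pairwise_disjoint_open (fun p => (hKc p).isClosed) hKd
  have hU : ∀ p : P, ∃ U ⊇ K p, IsOpen U ∧ totalVar μ U < ⊤ ∧ totalVar μ (U \ K p) < δ := fun p =>
    (hKc p).measurableSet.exists_isOpen_sdiff_lt (measure_ne_top _ _) hδ'
  choose U₂ hU₂K hU₂o _ hU₂δ using hU
  have hχ : ∀ p : P, ∃ χ : E → ℝ, ContDiff ℝ ∞ χ ∧ HasCompactSupport χ ∧
      tsupport χ ⊆ U₁ p ∩ U₂ p ∩ Ω ∧ (∀ x, χ x ∈ Icc (0 : ℝ) 1) ∧ ∀ x ∈ K p, χ x = 1 := fun p =>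
    exists_smooth_bump (hKc p) (((hU₁o p).inter (hU₂o p)).inter hΩ)
      (subset_inter (subset_inter (hU₁K p) (hU₂K p)) ((hKs p).trans inter_subset_right))
  choose χ hχs hχc hχt hχ01 hχ1 using hχ
  -- For a piece with `μ p = 0` the convention `0⁻¹ = 0` makes `v p = 0`, which is harmless.
  let v : P → EuclideanSpace ℝ ι := fun p => (‖ofComponents μ p‖)⁻¹ • ofComponents μ p
  have hv : ∀ p, ‖v p‖ ≤ 1 := fun p => by
    simp only [v, norm_smul, norm_inv, norm_norm]
    exact inv_mul_le_one
  have hvμ : ∀ p : P, inner ℝ (v p) (ofComponents μ p) = ‖ofComponents μ p‖ := fun p => by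
    simp only [v, real_inner_smul_left, real_inner_self_eq_norm_sq]
    rcases eq_or_ne ‖ofComponents μ p‖ 0 with h0 | h0
    · simp [h0]
    · field_simp
  let φ : E → EuclideanSpace ℝ ι := fun x => ∑ p, χ p x • v p
  have hφs : ContDiff ℝ 1 φ :=
    ContDiff.sum fun p _ => ((hχs p).of_le (by norm_cast)).smul contDiff_const
  have hφt : tsupport φ ⊆ ⋃ p, tsupport (χ p) := by
    refine closure_minimal (fun x hx => ?_)
      (isClosed_iUnion_of_finite fun p => isClosed_tsupport _)
    by_contra hcon
    refine hx (Finset.sum_eq_zero fun p _ => ?_)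
    rw [image_eq_zero_of_notMem_tsupport (fun h => hcon (mem_iUnion.2 ⟨p, h⟩)), zero_smul]
  have hφc : HasCompactSupport φ :=
    (isCompact_iUnion fun p => hχc p).of_isClosed_subset (isClosed_tsupport _) hφt
  have hφΩ : tsupport φ ⊆ Ω :=
    hφt.trans (iUnion_subset fun p => (hχt p).trans inter_subset_right)
  have hφ1 : ∀ x, ‖φ x‖ ≤ 1 := fun x => by
    by_cases hx : ∃ p, χ p x ≠ 0
    · obtain ⟨p, hp⟩ := hx
      have hp' : x ∈ U₁ p := ((hχt p) (subset_tsupport _ hp)).1.1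
      have : φ x = χ p x • v p := by
        refine Finset.sum_eq_single p (fun q _ hq => ?_) (by simp)
        have : χ q x = 0 := by
          by_contra hne
          exact disjoint_left.1 (hU₁d hq) ((hχt q) (subset_tsupport _ hne)).1.1 hp'
        rw [this, zero_smul]
      rw [this, norm_smul, Real.norm_eq_abs, abs_of_nonneg (hχ01 p x).1]
      exact mul_le_one₀ (hχ01 p x).2 (norm_nonneg _) (hv p)
    · push Not at hx
      have : φ x = 0 := Finset.sum_eq_zero fun p _ => by rw [hx p, zero_smul]
      simp [this]
  have hint : ∀ p, Integrable (fun x => χ p x • v p) (ofComponents μ).variation := fun p =>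
    (((hχs p).continuous.smul continuous_const).integrable_of_hasCompactSupport
      (hχc p).smul_right)
  have hφint : ∑ i, ∫ᵛ x, φ x i ∂•(μ i) =
      ∑ p, ∫ᵛ x, χ p x • v p ∂[innerSL ℝ; ofComponents μ] := by
    rw [← integral_inner_ofComponents μ (integrable_finsetSum _ fun p _ => hint p)]
    exact VectorMeasure.integral_finsetSum _ fun p _ => hint p
  have hmain : ∀ p : P, ‖ofComponents μ p‖ - 2 * δ ≤
      ∫ᵛ x, χ p x • v p ∂[innerSL ℝ; ofComponents μ] := fun p => by
    have hKm := (hKc p).measurableSet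
    have hind : Integrable ((K p).indicator fun _ => v p) (ofComponents μ).variation :=
      (integrable_const _).indicator hKm
    have e1 : ∫ᵛ x, (K p).indicator (fun _ => v p) x ∂[innerSL ℝ; ofComponents μ] =
        inner ℝ (v p) (ofComponents μ (K p)) := by
      rw [VectorMeasure.integral_indicator_const _ hKm]
      exact innerSL_apply_apply ℝ _ _
    have e2 : |∫ᵛ x, χ p x • v p ∂[innerSL ℝ; ofComponents μ] -
        inner ℝ (v p) (ofComponents μ (K p))| ≤ δ := by
      rw [← e1, ← VectorMeasure.integral_fun_sub (hint p) hind, ← Real.norm_eq_abs]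
      refine VectorMeasure.norm_integral_le_integral_norm.trans ?_
      have h1 : ‖(innerSL ℝ : EuclideanSpace ℝ ι →L[ℝ] _)‖ ≤ 1 := norm_innerSL_le ℝ
      have h2 : ∫ x, ‖χ p x • v p - (K p).indicator (fun _ => v p) x‖
          ∂(ofComponents μ).variation ≤ ∫ x, (U₂ p \ K p).indicator (fun _ => (1 : ℝ)) x
            ∂(ofComponents μ).variation := by
        refine integral_mono ((hint p).sub hind).norm
          ((integrable_const _).indicator ((hU₂o p).measurableSet.diff hKm)) fun x => ?_
        by_cases hx : x ∈ K p
        · simp [hx, hχ1 p x hx]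
        · by_cases hx2 : x ∈ U₂ p
          · simp only [hx, not_false_eq_true, indicator_of_notMem, sub_zero, norm_smul,
              Real.norm_eq_abs, abs_of_nonneg (hχ01 p x).1, Set.mem_sdiff, hx2, and_self,
              indicator_of_mem]
            exact mul_le_one₀ (hχ01 p x).2 (norm_nonneg _) (hv p)
          · have : χ p x = 0 := by
              by_contra hne
              exact hx2 ((hχt p) (subset_tsupport _ hne)).1.2
            simp [hx, hx2, this]
      rw [integral_indicator_const _ ((hU₂o p).measurableSet.diff hKm)] at h2
      have h3 : (ofComponents μ).variation.real (U₂ p \ K p) ≤ δ :=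
        by
          refine ENNReal.toReal_le_of_le_ofReal δ.2 ?_
          rw [ENNReal.ofReal_coe_nnreal]
          exact (hU₂δ p).le
      calc _ ≤ 1 * ∫ x, ‖χ p x • v p - (K p).indicator (fun _ => v p) x‖
          ∂(ofComponents μ).variation := by gcongr
        _ ≤ _ := by
          rw [one_mul]
          refine h2.trans ?_
          simpa using h3
    have e3 : ‖ofComponents μ p‖ - inner ℝ (v p) (ofComponents μ (K p)) ≤ δ := by
      rw [← hvμ p, ← inner_sub_right]
      have hKp : K p ⊆ (p : Set E) := (hKs p).trans inter_subset_left
      have hdiff : ofComponents μ p - ofComponents μ (K p) =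
          ofComponents μ ((p : Set E) \ K p) := by
        rw [← VectorMeasure.of_add_of_sdiff hKm (hPm p p.2) hKp, add_sub_cancel_left]
      rw [hdiff]
      refine (real_inner_le_norm _ _).trans ?_
      have h4 : ‖ofComponents μ ((p : Set E) \ K p)‖ ≤ δ := by
        refine (VectorMeasure.norm_measure_le_variation).trans ?_
        refine ENNReal.toReal_le_of_le_ofReal δ.2 ?_
        have : ((p : Set E) \ K p) ⊆ (((p : Set E) ∩ Ω) \ K p) ∪ Ωᶜ := by
          intro x hx
          by_cases hxΩ : x ∈ Ω
          · exact Or.inl ⟨⟨hx.1, hxΩ⟩, hx.2⟩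
          · exact Or.inr hxΩ
        refine (measure_mono this).trans ((measure_union_le _ _).trans ?_)
        change totalVar μ _ + totalVar μ _ ≤ _
        rw [hΩ0, add_zero]
        simpa using (hKδ p).le
      calc ‖v p‖ * ‖ofComponents μ ((p : Set E) \ K p)‖ ≤ 1 * δ := by
            gcongr
            exact hv p
        _ = δ := one_mul _
    have := (abs_le.1 e2).1
    linarith
  have hle : ∑ p ∈ P, ‖ofComponents μ p‖ ≤ C + 2 * P.card * δ := by
    have h1 := h φ hφs hφc hφΩ hφ1
    rw [hφint] at h1
    have h2 := (Finset.sum_le_sum fun p (_ : p ∈ Finset.univ) => hmain p).trans h1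
    rw [Finset.sum_sub_distrib, Finset.sum_const, Finset.card_univ, Fintype.card_coe,
      nsmul_eq_mul, Finset.univ_eq_attach,
      Finset.sum_attach P (fun p => ‖ofComponents μ p‖)] at h2
    linarith
  calc totalVar μ univ ≤ ∑ p ∈ P, ‖ofComponents μ p‖ₑ + (ε / 2 : ℝ≥0) := hP
    _ = ENNReal.ofReal (∑ p ∈ P, ‖ofComponents μ p‖) + (ε / 2 : ℝ≥0) := by
        rw [ENNReal.ofReal_sum_of_nonneg fun _ _ => norm_nonneg _]
        simp only [ofReal_norm]
    _ ≤ ENNReal.ofReal (C + ((2 * P.card * δ : ℝ≥0) : ℝ)) + (ε / 2 : ℝ≥0) := by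
        gcongr
        push_cast
        exact hle
    _ ≤ ENNReal.ofReal C + (ε / 2 : ℝ≥0) + (ε / 2 : ℝ≥0) := by
        gcongr
        refine ENNReal.ofReal_add_le.trans ?_
        gcongr
        rw [ENNReal.ofReal_coe_nnreal]
        exact_mod_cast hδP
    _ = ENNReal.ofReal C + ε := by
        rw [add_assoc, ← ENNReal.coe_add, add_halves]

lemma eq_of_forall_integral_eq {Ω : Set E} (hΩ : IsOpen Ω) {μ ν : SignedMeasure E}
    (hμ : ∀ A, MeasurableSet A → Disjoint A Ω → μ A = 0)
    (hν : ∀ A, MeasurableSet A → Disjoint A Ω → ν A = 0)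
    (h : ∀ ψ : E → ℝ, ContDiff ℝ 1 ψ → HasCompactSupport ψ → tsupport ψ ⊆ Ω →
      ∫ᵛ x, ψ x ∂•μ = ∫ᵛ x, ψ x ∂•ν) : μ = ν := by
  have : ProperSpace E := FiniteDimensional.proper ℝ E
  -- Uniqueness is the duality bound with constant `0` for a one-component family.
  have key : totalVar (fun _ : Unit => μ - ν) univ ≤ ENNReal.ofReal 0 := by
    refine totalVar_univ_le_of_forall_integral_le hΩ (fun _ A hA hd => ?_)
      fun φ hφ hφc hφΩ _ => ?_
    · simp [hμ A hA hd, hν A hA hd]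
    · have hψ : ContDiff ℝ 1 fun x => φ x () := by fun_prop
      have hcs : HasCompactSupport fun x => φ x () :=
        hφc.comp_left (g := fun v : EuclideanSpace ℝ Unit => v ()) rfl
      have hts : tsupport (fun x => φ x ()) ⊆ Ω :=
        (tsupport_comp_subset (g := fun v : EuclideanSpace ℝ Unit => v ()) rfl φ).trans hφΩ
      have hint : ∀ ρ : SignedMeasure E, ρ.Integrable fun x => φ x () := fun ρ =>
        hψ.continuous.integrable_of_hasCompactSupport hcs
      simp [VectorMeasure.integral_sub_vectorMeasure (hint μ) (hint ν), h _ hψ hcs hts]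
  have h0 : totalVar (fun _ : Unit => μ - ν) = 0 := by simpa using key
  exact sub_eq_zero.1 (totalVar_eq_zero h0 ())

end Duality

/-! ### Divergence as a trace, and the divergence theorem for compactly supported fields. -/

section Divergence

variable {E : Type*} [NormedAddCommGroup E] [NormedSpace ℝ E] [FiniteDimensional ℝ E]

omit [FiniteDimensional ℝ E] in
@[simp] lemma divergence_const (v x : E) : divergence (fun _ : E => v) x = 0 := by
  simp [divergence]

lemma divergence_smul {g : E → ℝ} {X : E → E} {x : E} (hg : DifferentiableAt ℝ g x)
    (hX : DifferentiableAt ℝ X x) :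
    divergence (fun y => g y • X y) x = g x * divergence X x + fderiv ℝ g x (X x) := by
  rw [divergence, fderiv_fun_smul hg hX, ContinuousLinearMap.toLinearMap_add, map_add,
    ContinuousLinearMap.toLinearMap_smul, map_smul, smul_eq_mul, divergence]
  congr 1
  exact LinearMap.trace_smulRight _ _

omit [FiniteDimensional ℝ E] in
lemma divergence_sub {V W : E → E} {x : E} (hV : DifferentiableAt ℝ V x)
    (hW : DifferentiableAt ℝ W x) :
    divergence (fun y => V y - W y) x = divergence V x - divergence W x := by
  rw [divergence, fderiv_fun_sub hV hW]
  simp [divergence]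

/-- The trace as a continuous linear functional. -/
def traceL (E : Type*) [NormedAddCommGroup E] [NormedSpace ℝ E] [FiniteDimensional ℝ E] :
    (E →L[ℝ] E) →L[ℝ] ℝ :=
  LinearMap.toContinuousLinearMap (LinearMap.trace ℝ E ∘ₗ ContinuousLinearMap.coeLM ℝ)

lemma continuous_divergence {V : E → E} (hV : ContDiff ℝ 1 V) : Continuous (divergence V) :=
  (traceL E).continuous.comp (hV.continuous_fderiv one_ne_zero)

lemma tsupport_divergence_subset (V : E → E) : tsupport (divergence V) ⊆ tsupport V :=
  (tsupport_comp_subset (g := traceL E) (map_zero _) _).trans (tsupport_fderiv_subset ℝ)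

lemma hasCompactSupport_divergence {V : E → E} (hV : HasCompactSupport V) :
    HasCompactSupport (divergence V) :=
  IsCompact.of_isClosed_subset hV (isClosed_tsupport _) (tsupport_divergence_subset V)

variable [MeasurableSpace E] [BorelSpace E]

lemma integral_fderiv_apply_eq_zero (μ : Measure E) [μ.IsAddHaarMeasure] {g : E → ℝ}
    (hg : ContDiff ℝ 1 g) (hc : HasCompactSupport g) (v : E) :
    ∫ x, fderiv ℝ g x v ∂μ = 0 := by
  have h1 : Integrable (fun x => fderiv ℝ g x v) μ :=
    ((hg.continuous_fderiv one_ne_zero).clm_apply continuous_const).integrable_of_hasCompactSupport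
      (hc.fderiv_apply ℝ v)
  have h := integral_mul_fderiv_eq_neg_fderiv_mul_of_integrable (𝕜 := ℝ) (μ := μ) (v := v)
    (f := fun _ => (1 : ℝ)) (g := g) (by simp) (by simpa using h1)
    (by simpa using hg.continuous.integrable_of_hasCompactSupport hc)
    (fun x _ => by fun_prop) (fun x _ => (hg.differentiable one_ne_zero) x)
  simpa using h

/-- In a basis the trace is a sum of directional derivatives of compactly supported functions, each
with zero integral. -/
lemma integral_divergence_eq_zero (μ : Measure E) [μ.IsAddHaarMeasure] {V : E → E}
    (hV : ContDiff ℝ 1 V) (hc : HasCompactSupport V) : ∫ x, divergence V x ∂μ = 0 := by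
  let b := Module.finBasis ℝ E
  let c : Fin (Module.finrank ℝ E) → E →L[ℝ] ℝ := fun i =>
    LinearMap.toContinuousLinearMap (b.coord i)
  have hdiv : ∀ x, divergence V x = ∑ i, fderiv ℝ (fun y => c i (V y)) x (b i) := fun x => by
    rw [divergence, LinearMap.trace_eq_matrix_trace ℝ b, Matrix.trace]
    refine Finset.sum_congr rfl fun i _ => ?_
    have h1 : fderiv ℝ (fun y => c i (V y)) x = (c i).comp (fderiv ℝ V x) :=
      ((c i).hasFDerivAt.comp x (hV.differentiable one_ne_zero x).hasFDerivAt).fderiv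
    rw [h1, Matrix.diag_apply, LinearMap.toMatrix_apply]
    rfl
  have hcV : ∀ i, ContDiff ℝ 1 fun y => c i (V y) := fun i => (c i).contDiff.comp hV
  have hcc : ∀ i, HasCompactSupport fun y => c i (V y) := fun i =>
    hc.comp_left (g := c i) (map_zero _)
  simp_rw [hdiv]
  rw [integral_finsetSum]
  · exact Finset.sum_eq_zero fun i _ => integral_fderiv_apply_eq_zero μ (hcV i) (hcc i) _
  · intro i _
    exact (((hcV i).continuous_fderiv one_ne_zero).clm_apply
      continuous_const).integrable_of_hasCompactSupport ((hcc i).fderiv_apply ℝ _)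

end Divergence

/-! ### Divergence of lifted and vertical fields. -/

section Product

variable {E : Type*} [NormedAddCommGroup E] [NormedSpace ℝ E] [FiniteDimensional ℝ E]

/-- The derivative is `inl ∘ A ∘ fst` with `A` the derivative of `X`; cyclicity of the trace brings
`fst` next to `inl`, where they cancel. -/
lemma divergence_prod_zero {X : E → E} {p : E × ℝ} (hX : DifferentiableAt ℝ X p.1) :
    divergence (fun q : E × ℝ => ((X q.1, 0) : E × ℝ)) p = divergence X p.1 := by
  have h : HasFDerivAt (fun q : E × ℝ => ((X q.1, 0) : E × ℝ))
      ((ContinuousLinearMap.inl ℝ E ℝ).comp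
        ((fderiv ℝ X p.1).comp (ContinuousLinearMap.fst ℝ E ℝ))) p :=
    (ContinuousLinearMap.inl ℝ E ℝ).hasFDerivAt.comp p
      (hX.hasFDerivAt.comp p hasFDerivAt_fst)
  rw [divergence, h.fderiv, divergence]
  rw [ContinuousLinearMap.toLinearMap_comp, LinearMap.trace_comp_comm',
    ContinuousLinearMap.toLinearMap_comp, LinearMap.comp_assoc]
  congr 1

lemma divergence_smul_lift {X : E → E} {φ : E × ℝ → ℝ} {p : E × ℝ}
    (hφ : DifferentiableAt ℝ φ p) (hX : DifferentiableAt ℝ X p.1) :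
    divergence (fun q : E × ℝ => φ q • ((X q.1, 0) : E × ℝ)) p =
      φ p * divergence X p.1 + fderiv ℝ φ p (X p.1, 0) := by
  rw [divergence_smul hφ, divergence_prod_zero hX]
  exact (hX.comp p differentiableAt_fst).prodMk (differentiableAt_const _)

lemma divergence_smul_vertical {φ : E × ℝ → ℝ} {p : E × ℝ} (hφ : DifferentiableAt ℝ φ p) :
    divergence (fun q : E × ℝ => φ q • ((0, 1) : E × ℝ)) p = fderiv ℝ φ p (0, 1) := by
  rw [divergence_smul hφ (differentiableAt_const _), divergence_const, mul_zero, zero_add]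

end Product

/-! ### Distributional derivatives along a single field. -/

section WeakDeriv

variable {E : Type*} [NormedAddCommGroup E] [NormedSpace ℝ E] [FiniteDimensional ℝ E]
  [MeasureSpace E] [BorelSpace E] {ι : Type*} [Fintype ι]

/-- `μ` is the distributional derivative of `u` along the vector field `Y` on `Ω`. -/
def HasWeakDeriv (Y : E → E) (Ω : Set E) (u : E → ℝ) (μ : SignedMeasure E) : Prop :=
  ∀ ψ : E → ℝ, ContDiff ℝ 1 ψ → HasCompactSupport ψ → tsupport ψ ⊆ Ω →
    ∫ᵛ x, ψ x ∂•μ = -∫ x in Ω, u x * divergence (fun y => ψ y • Y y) x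

omit [NormedSpace ℝ E] [FiniteDimensional ℝ E] in
lemma integrableOn_mul_of_tsupport_subset {Ω : Set E} (hΩ : IsOpen Ω) {u g : E → ℝ}
    (hu : LocallyIntegrableOn u Ω) (hg : Continuous g) (hc : HasCompactSupport g)
    (ht : tsupport g ⊆ Ω) : IntegrableOn (fun x => u x * g x) Ω := by
  have h1 : IntegrableOn (fun x => u x * g x) (tsupport g) :=
    (hu.integrableOn_compact_subset ht hc).mul_continuousOn hg.continuousOn hc
  refine h1.of_forall_sdiff_eq_zero hΩ.measurableSet fun x hx => ?_
  rw [image_eq_zero_of_notMem_tsupport hx.2, mul_zero]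

/-- Test fields with one nonzero component decouple the system; local integrability allows the
integral of the sum to be split for the converse. Finite total variation is automatic because signed
measures are finite. -/
lemma isHDeriv_iff {X : ι → E → E} (hX : ∀ i, ContDiff ℝ 1 (X i)) {Ω : Set E} (hΩ : IsOpen Ω)
    {u : E → ℝ} (hu : LocallyIntegrableOn u Ω) {D : ι → SignedMeasure E} :
    IsHDeriv X Ω u D ↔ (∀ i A, MeasurableSet A → Disjoint A Ω → D i A = 0) ∧
      ∀ i, HasWeakDeriv (X i) Ω u (D i) := by
  classical
  constructor
  · refine fun h => ⟨h.concentrated, fun i ψ hψ hc ht => ?_⟩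
    have := h.integral_eq (fun x => EuclideanSpace.single i (ψ x)) ?_ ?_ ?_
    · rw [Finset.sum_eq_single i ?_ (by simp)] at this
      · have hdiv : ∀ x, divX X (fun x => EuclideanSpace.single i (ψ x)) x =
            divergence (fun y => ψ y • X i y) x := fun x => by
          rw [divX, Finset.sum_eq_single i ?_ (by simp)]
          · simp
          · intro j _ hj
            simp [hj]
        simpa [hdiv] using this
      · intro j _ hj
        simp [hj]
    · rw [contDiff_euclidean]
      intro j
      by_cases hj : j = i
      · subst hj
        simpa using hψ
      · simpa [hj] using contDiff_const
    · exact hc.comp_left (g := fun r : ℝ => EuclideanSpace.single i r) (by simp)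
    · exact (tsupport_comp_subset (g := fun r : ℝ => EuclideanSpace.single i r)
        (by simp) ψ).trans ht
  · rintro ⟨hc, h⟩
    refine ⟨hc, measure_lt_top _ _, fun φ hφ hφc hφt => ?_⟩
    have hφi : ∀ i, ContDiff ℝ 1 fun x => φ x i := fun i => by fun_prop
    have hci : ∀ i, HasCompactSupport fun x => φ x i := fun i =>
      hφc.comp_left (g := fun v : EuclideanSpace ℝ ι => v i) rfl
    have hti : ∀ i, tsupport (fun x => φ x i) ⊆ Ω := fun i =>
      (tsupport_comp_subset (g := fun v : EuclideanSpace ℝ ι => v i) rfl φ).trans hφt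
    have hVi : ∀ i, ContDiff ℝ 1 fun y => φ y i • X i y := fun i => (hφi i).smul (hX i)
    simp_rw [divX, Finset.mul_sum]
    rw [integral_finsetSum, ← Finset.sum_neg_distrib]
    · exact Finset.sum_congr rfl fun i _ => h i _ (hφi i) (hci i) (hti i)
    · intro i _
      refine integrableOn_mul_of_tsupport_subset hΩ hu (continuous_divergence (hVi i))
        (hasCompactSupport_divergence (hci i).smul_right) ?_
      exact (tsupport_divergence_subset _).trans
        ((closure_mono (Function.support_smul_subset_left _ _)).trans (hti i))

end WeakDeriv

lemma isClosedEmbedding_prodMkRight {X Y : Type*} [TopologicalSpace X] [TopologicalSpace Y]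
    [T1Space X] (x : X) : IsClosedEmbedding (Prod.mk x : Y → X × Y) := by
  refine ⟨isEmbedding_prodMkRight x, ?_⟩
  have : range (Prod.mk x : Y → X × Y) = Prod.fst ⁻¹' {x} := by
    ext ⟨a, b⟩
    simp [eq_comm]
  rw [this]
  exact isClosed_singleton.preimage continuous_fst

lemma isClosedEmbedding_prodMkLeft {X Y : Type*} [TopologicalSpace X] [TopologicalSpace Y]
    [T1Space Y] (y : Y) : IsClosedEmbedding (fun x : X => (x, y)) := by
  refine ⟨isEmbedding_prodMkLeft y, ?_⟩
  have : range (fun x : X => (x, y)) = Prod.snd ⁻¹' {y} := by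
    ext ⟨a, b⟩
    simp [eq_comm]
  rw [this]
  exact isClosed_singleton.preimage continuous_snd

/-! ### Integration over subgraphs. -/

section Subgraph

variable {n : ℕ}

lemma measurableSet_lt_comp_fst {v : EuclideanSpace ℝ (Fin n) → ℝ} (hv : Measurable v) :
    MeasurableSet {p : EuclideanSpace ℝ (Fin n) × ℝ | p.2 < v p.1} :=
  measurableSet_lt measurable_snd (hv.comp measurable_fst)

lemma integrable_indicator_lt {v : EuclideanSpace ℝ (Fin n) → ℝ} (hv : Measurable v)
    {G : EuclideanSpace ℝ (Fin n) × ℝ → ℝ} (hG : Integrable G) :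
    Integrable ({p : EuclideanSpace ℝ (Fin n) × ℝ | p.2 < v p.1}.indicator G) :=
  hG.indicator (measurableSet_lt_comp_fst hv)

lemma setIntegral_Iio_eq {v : EuclideanSpace ℝ (Fin n) → ℝ}
    (G : EuclideanSpace ℝ (Fin n) × ℝ → ℝ) (x : EuclideanSpace ℝ (Fin n)) :
    ∫ t in Iio (v x), G (x, t) =
      ∫ t, {p : EuclideanSpace ℝ (Fin n) × ℝ | p.2 < v p.1}.indicator G (x, t) := by
  rw [← integral_indicator measurableSet_Iio]
  rfl

lemma integrable_setIntegral_Iio {v : EuclideanSpace ℝ (Fin n) → ℝ} (hv : Measurable v)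
    {G : EuclideanSpace ℝ (Fin n) × ℝ → ℝ} (hG : Integrable G) :
    Integrable fun x => ∫ t in Iio (v x), G (x, t) := by
  simp_rw [setIntegral_Iio_eq G]
  exact (integrable_indicator_lt hv hG).integral_prod_left

lemma ae_mem_imp_eq_fst {Ω : Set (EuclideanSpace ℝ (Fin n))} (hΩ : MeasurableSet Ω)
    {u v : EuclideanSpace ℝ (Fin n) → ℝ} (huv : u =ᵐ[volume.restrict Ω] v) :
    ∀ᵐ p : EuclideanSpace ℝ (Fin n) × ℝ, p.1 ∈ Ω → u p.1 = v p.1 := by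
  rw [Filter.EventuallyEq, ae_restrict_iff' hΩ] at huv
  exact Measure.quasiMeasurePreserving_fst.ae huv

/-- Integration over the subgraph, by Fubini. -/
lemma integral_indicator_subgraph_mul {Ω : Set (EuclideanSpace ℝ (Fin n))} (hΩ : MeasurableSet Ω)
    {u v : EuclideanSpace ℝ (Fin n) → ℝ} (hv : Measurable v) (huv : u =ᵐ[volume.restrict Ω] v)
    {G : EuclideanSpace ℝ (Fin n) × ℝ → ℝ} (hG : Integrable G)
    (hG0 : ∀ p, p.1 ∉ Ω → G p = 0) :
    ∫ p in Ω ×ˢ (univ : Set ℝ), (subgraph Ω u).indicator (fun _ => (1 : ℝ)) p * G p =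
      ∫ x, ∫ t in Iio (v x), G (x, t) := by
  have h0 : ∀ p ∉ Ω ×ˢ (univ : Set ℝ),
      (subgraph Ω u).indicator (fun _ => (1 : ℝ)) p * G p = 0 := fun p hp => by
    rw [hG0 p (fun h => hp ⟨h, mem_univ _⟩), mul_zero]
  rw [setIntegral_eq_integral_of_forall_compl_eq_zero h0]
  have h1 : ∀ᵐ p : EuclideanSpace ℝ (Fin n) × ℝ,
      (subgraph Ω u).indicator (fun _ => (1 : ℝ)) p * G p =
        {p : EuclideanSpace ℝ (Fin n) × ℝ | p.2 < v p.1}.indicator G p := by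
    filter_upwards [ae_mem_imp_eq_fst hΩ huv] with p hp
    by_cases hpΩ : p.1 ∈ Ω
    · by_cases hlt : p.2 < v p.1
      · have : p ∈ subgraph Ω u := ⟨hpΩ, by rwa [hp hpΩ]⟩
        simp [this, hlt]
      · have : p ∉ subgraph Ω u := fun h => hlt (by rw [← hp hpΩ]; exact h.2)
        simp [this, hlt]
    · rw [hG0 p hpΩ, mul_zero, indicator_apply, hG0 p hpΩ, ite_self]
  rw [integral_congr_ae h1, Measure.volume_eq_prod,
    integral_prod _ (integrable_indicator_lt hv hG)]
  simp_rw [setIntegral_Iio_eq G]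

lemma locallyIntegrableOn_indicator_subgraph {Ω : Set (EuclideanSpace ℝ (Fin n))}
    (hΩ : MeasurableSet Ω) {u v : EuclideanSpace ℝ (Fin n) → ℝ} (hv : Measurable v)
    (huv : u =ᵐ[volume.restrict Ω] v) (s : Set (EuclideanSpace ℝ (Fin n) × ℝ)) :
    LocallyIntegrableOn ((subgraph Ω u).indicator fun _ => (1 : ℝ)) s := by
  refine LocallyIntegrable.locallyIntegrableOn ?_ s
  have hm : MeasurableSet ((Ω ×ˢ univ) ∩ {p : EuclideanSpace ℝ (Fin n) × ℝ | p.2 < v p.1}) :=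
    (hΩ.prod MeasurableSet.univ).inter (measurableSet_lt_comp_fst hv)
  have h1 : LocallyIntegrable (((Ω ×ˢ univ) ∩
      {p : EuclideanSpace ℝ (Fin n) × ℝ | p.2 < v p.1}).indicator fun _ => (1 : ℝ)) :=
    (locallyIntegrable_const 1).indicator hm
  refine h1.congr ?_
  filter_upwards [ae_mem_imp_eq_fst hΩ huv] with p hp
  classical
  rw [indicator_apply, indicator_apply]
  refine if_congr ?_ rfl rfl
  by_cases hpΩ : p.1 ∈ Ω
  · simp [subgraph, hpΩ, hp hpΩ]
  · simp [subgraph, hpΩ]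

lemma abs_setIntegral_Iio_sub_le {g : ℝ → ℝ} (hg : Integrable g) {M : ℝ} (hM : ∀ t, |g t| ≤ M)
    (a b : ℝ) : |(∫ t in Iio a, g t) - ∫ t in Iio b, g t| ≤ M * |a - b| := by
  rw [intervalIntegral.integral_Iio_sub_Iio' hg.integrableOn hg.integrableOn]
  rw [← Real.norm_eq_abs]
  exact intervalIntegral.norm_integral_le_of_norm_le_const fun t _ => hM t

/-- The map `v ↦ ∫∫_{t < v} G` is Lipschitz for the `L¹` distance, with constant a bound of `|G|`:
changing `v x` only adds or removes an interval in `t`. -/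
lemma tendsto_integral_setIntegral_Iio {u : EuclideanSpace ℝ (Fin n) → ℝ} (hu : Measurable u)
    (hui : Integrable u)
    {w : ℕ → EuclideanSpace ℝ (Fin n) → ℝ} (hw : ∀ k, Measurable (w k))
    (hwi : ∀ k, Integrable (w k))
    (hwu : Tendsto (fun k => ∫ x, |w k x - u x|) atTop (𝓝 0))
    {G : EuclideanSpace ℝ (Fin n) × ℝ → ℝ} (hG : Continuous G) (hGc : HasCompactSupport G) :
    Tendsto (fun k => ∫ x, ∫ t in Iio (w k x), G (x, t)) atTop
      (𝓝 (∫ x, ∫ t in Iio (u x), G (x, t))) := by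
  have hGi : Integrable G := hG.integrable_of_hasCompactSupport hGc
  obtain ⟨M, hM⟩ := hG.bounded_above_of_compact_support hGc
  have hsl : ∀ x, Integrable fun t => G (x, t) := fun x => by
    refine (hG.comp (by fun_prop : Continuous fun t : ℝ => (x, t))).integrable_of_hasCompactSupport
      (hGc.comp_isClosedEmbedding ?_)
    exact (isClosedEmbedding_prodMkRight x)
  rw [tendsto_iff_norm_sub_tendsto_zero]
  refine squeeze_zero (fun _ => norm_nonneg _) (fun k => ?_) (by simpa using hwu.const_mul M)
  rw [← integral_sub (integrable_setIntegral_Iio (hw k) hGi) (integrable_setIntegral_Iio hu hGi),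
    ← integral_const_mul]
  refine norm_integral_le_of_norm_le (((hwi k).sub hui).abs.const_mul M)
    (Eventually.of_forall fun x => ?_)
  exact abs_setIntegral_Iio_sub_le (hsl x) (fun t => hM (x, t)) _ _

end Subgraph

/-! ### The derivative of the subgraph of a `C¹` function. -/

section ChainRule

variable {n : ℕ}

/-- The shear `(x, s) ↦ (x, v x + s)`. -/
def shear (v : EuclideanSpace ℝ (Fin n) → ℝ) (hv : Continuous v) :
    EuclideanSpace ℝ (Fin n) × ℝ ≃ₜ EuclideanSpace ℝ (Fin n) × ℝ where
  toFun p := (p.1, v p.1 + p.2)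
  invFun p := (p.1, p.2 - v p.1)
  left_inv p := by simp
  right_inv p := by simp
  continuous_toFun := by fun_prop
  continuous_invFun := by fun_prop

lemma hasCompactSupport_comp_shear {v : EuclideanSpace ℝ (Fin n) → ℝ} (hv : Continuous v)
    {β : Type*} [Zero β] {φ : EuclideanSpace ℝ (Fin n) × ℝ → β} (hφ : HasCompactSupport φ) :
    HasCompactSupport fun p : EuclideanSpace ℝ (Fin n) × ℝ => φ (p.1, v p.1 + p.2) :=
  hφ.comp_homeomorph (shear v hv)

lemma hasCompactSupport_slice {β : Type*} [Zero β] {φ : EuclideanSpace ℝ (Fin n) × ℝ → β}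
    (hφ : HasCompactSupport φ) (s : ℝ) : HasCompactSupport fun x => φ (x, s) :=
  hφ.comp_isClosedEmbedding (isClosedEmbedding_prodMkLeft s)

lemma integral_Iio_fderiv_vertical {φ : EuclideanSpace ℝ (Fin n) × ℝ → ℝ} (hφ : ContDiff ℝ 1 φ)
    (hc : HasCompactSupport φ) (x : EuclideanSpace ℝ (Fin n)) (a : ℝ) :
    ∫ t in Iio a, fderiv ℝ φ (x, t) (0, 1) = φ (x, a) := by
  have hd : ∀ t, HasDerivAt (fun t => φ (x, t)) (fderiv ℝ φ (x, t) (0, 1)) t := fun t =>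
    ((hφ.differentiable one_ne_zero (x, t)).hasFDerivAt.comp_hasDerivAt t
      ((hasDerivAt_const t x).prodMk (hasDerivAt_id t)))
  have hsm : ContDiff ℝ 1 fun t => φ (x, t) := hφ.comp (by fun_prop)
  have hcs : HasCompactSupport fun t => φ (x, t) :=
    hc.comp_isClosedEmbedding (isClosedEmbedding_prodMkRight x)
  rw [← integral_Iic_eq_integral_Iio, ← hcs.integral_Iic_deriv_eq hsm a]
  exact integral_congr_ae (Eventually.of_forall fun t => (hd t).deriv.symm)

lemma setIntegral_Iio_eq_shift (g : ℝ → ℝ) (a : ℝ) :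
    ∫ t in Iio a, g t = ∫ s in Iio 0, g (a + s) := by
  rw [← integral_indicator measurableSet_Iio, ← integral_indicator measurableSet_Iio,
    ← integral_add_left_eq_self _ a]
  congr 1
  funext s
  by_cases hs : s < 0
  · rw [indicator_of_mem (by simpa using hs), indicator_of_mem (by simpa using hs)]
  · rw [indicator_of_notMem (by simpa using hs), indicator_of_notMem (by simpa using hs)]

lemma divergence_smul_comp_graph {v : EuclideanSpace ℝ (Fin n) → ℝ}
    {X : EuclideanSpace ℝ (Fin n) → EuclideanSpace ℝ (Fin n)}
    {φ : EuclideanSpace ℝ (Fin n) × ℝ → ℝ} {s : ℝ} {x : EuclideanSpace ℝ (Fin n)}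
    (hv : DifferentiableAt ℝ v x) (hX : DifferentiableAt ℝ X x)
    (hφ : DifferentiableAt ℝ φ (x, v x + s)) :
    divergence (fun y => φ (y, v y + s) • X y) x =
      φ (x, v x + s) * divergence X x + fderiv ℝ φ (x, v x + s) (X x, fderiv ℝ v x (X x)) := by
  have h1 : HasFDerivAt (fun y => φ (y, v y + s))
      ((fderiv ℝ φ (x, v x + s)).comp ((ContinuousLinearMap.id ℝ _).prod (fderiv ℝ v x))) x :=
    HasFDerivAt.comp x (g := φ) (f := fun y => (y, v y + s)) hφ.hasFDerivAt
      ((hasFDerivAt_id x).prodMk (hv.hasFDerivAt.add_const s))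
  rw [divergence_smul h1.differentiableAt hX, h1.fderiv]
  rfl

/-- The chain rule for the primitive in `t` of a divergence, along the graph of a `C¹` function. -/
lemma integral_Iio_divergence_eq {v : EuclideanSpace ℝ (Fin n) → ℝ} (hv : ContDiff ℝ 1 v)
    {X : EuclideanSpace ℝ (Fin n) → EuclideanSpace ℝ (Fin n)} (hX : ContDiff ℝ 1 X)
    {φ : EuclideanSpace ℝ (Fin n) × ℝ → ℝ} (hφ : ContDiff ℝ 1 φ) (hc : HasCompactSupport φ) :
    ∫ x, ∫ t in Iio (v x), (φ (x, t) * divergence X x + fderiv ℝ φ (x, t) (X x, 0)) =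
      -∫ x, φ (x, v x) * fderiv ℝ v x (X x) := by
  have hφ' : Continuous (fderiv ℝ φ) := hφ.continuous_fderiv one_ne_zero
  have hv' : Continuous (fderiv ℝ v) := hv.continuous_fderiv one_ne_zero
  have hvc := hv.continuous
  have hXc := hX.continuous
  have hφc := hφ.continuous
  have hdX := continuous_divergence hX
  -- After the substitution `t = v x + s` the domain `s < 0` no longer depends on `x`. For fixed
  -- `s`, `A` is a full divergence in `x`, and `B` is the chain rule term by which it exceeds the
  -- integrand.
  let A : EuclideanSpace ℝ (Fin n) × ℝ → ℝ := fun p =>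
    φ (p.1, v p.1 + p.2) * divergence X p.1 +
      fderiv ℝ φ (p.1, v p.1 + p.2) (X p.1, fderiv ℝ v p.1 (X p.1))
  let B : EuclideanSpace ℝ (Fin n) × ℝ → ℝ := fun p =>
    fderiv ℝ φ (p.1, v p.1 + p.2) (0, 1) * fderiv ℝ v p.1 (X p.1)
  have hcs1 : HasCompactSupport fun p : EuclideanSpace ℝ (Fin n) × ℝ => φ (p.1, v p.1 + p.2) :=
    hasCompactSupport_comp_shear hvc hc
  have hcs2 : HasCompactSupport
      fun p : EuclideanSpace ℝ (Fin n) × ℝ => fderiv ℝ φ (p.1, v p.1 + p.2) :=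
    hasCompactSupport_comp_shear hvc (hc.fderiv ℝ)
  have hA : Continuous A := by fun_prop
  have hB : Continuous B := by fun_prop
  have hAc : HasCompactSupport A := by
    refine hcs1.mul_right.add (hcs2.mono fun p hp h0 => hp ?_)
    simp only [h0, zero_apply]
  have hBc : HasCompactSupport B := by
    refine hcs2.mono fun p hp h0 => hp ?_
    simp only [B, h0, zero_apply, zero_mul]
  have hAi : Integrable A := hA.integrable_of_hasCompactSupport hAc
  have hBi : Integrable B := hB.integrable_of_hasCompactSupport hBc
  have hAr : Integrable A ((volume : Measure (EuclideanSpace ℝ (Fin n))).prod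
      (volume.restrict (Iio (0 : ℝ)))) :=
    hAi.mono_measure (Measure.prod_mono le_rfl Measure.restrict_le_self)
  have hBr : Integrable B ((volume : Measure (EuclideanSpace ℝ (Fin n))).prod
      (volume.restrict (Iio (0 : ℝ)))) :=
    hBi.mono_measure (Measure.prod_mono le_rfl Measure.restrict_le_self)
  have hslice : ∀ (f : EuclideanSpace ℝ (Fin n) × ℝ → ℝ), Continuous f → HasCompactSupport f →
      ∀ x, IntegrableOn (fun t => f (x, t)) (Iio 0) := fun f hf hfc x =>
    ((hf.comp (by fun_prop : Continuous fun t : ℝ => (x, t))).integrable_of_hasCompactSupport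
      (hfc.comp_isClosedEmbedding (isClosedEmbedding_prodMkRight x))).integrableOn
  have hshift : ∀ x, ∫ t in Iio (v x),
      (φ (x, t) * divergence X x + fderiv ℝ φ (x, t) (X x, 0)) =
        (∫ s in Iio 0, A (x, s)) - ∫ s in Iio 0, B (x, s) := fun x => by
    rw [← integral_sub (hslice A hA hAc x) (hslice B hB hBc x), setIntegral_Iio_eq_shift]
    congr 1
    funext s
    have : ((X x, fderiv ℝ v x (X x)) : EuclideanSpace ℝ (Fin n) × ℝ) =
        (X x, 0) + fderiv ℝ v x (X x) • (0, 1) := by simp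
    simp only [A, B]
    rw [this, map_add, map_smul, smul_eq_mul]
    ring
  have hA0 : ∫ x, ∫ s in Iio 0, A (x, s) = 0 := by
    rw [integral_integral_swap (f := fun x s => A (x, s)) hAr]
    refine integral_eq_zero_of_ae (Eventually.of_forall fun s => ?_)
    have hH : ContDiff ℝ 1 fun x => φ (x, v x + s) := hφ.comp (by fun_prop)
    have hAdiv : ∀ x, A (x, s) = divergence (fun y => φ (y, v y + s) • X y) x := fun x =>
      (divergence_smul_comp_graph (hv.differentiable one_ne_zero x)
        (hX.differentiable one_ne_zero x) (hφ.differentiable one_ne_zero _)).symm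
    simp only [hAdiv, Pi.zero_apply]
    have hV : ContDiff ℝ 1 fun y => φ (y, v y + s) • X y := hH.smul hX
    have hVs : HasCompactSupport fun y => φ (y, v y + s) := hasCompactSupport_slice hcs1 s
    have hVc : HasCompactSupport fun y => φ (y, v y + s) • X y :=
      hVs.mono fun y hy h0 => hy (by
        change φ (y, v y + s) • X y = 0
        rw [show φ (y, v y + s) = 0 from h0, zero_smul])
    exact integral_divergence_eq_zero volume hV hVc
  -- `B` is a `t`-derivative times a factor independent of `t`, so only the value on the graph
  -- survives.
  have hB1 : ∀ x, ∫ s in Iio 0, B (x, s) = φ (x, v x) * fderiv ℝ v x (X x) := fun x => by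
    simp only [B]
    rw [integral_mul_const,
      ← setIntegral_Iio_eq_shift (fun t => fderiv ℝ φ (x, t) (0, 1)) (v x),
      integral_Iio_fderiv_vertical hφ hc]
  simp_rw [hshift]
  rw [integral_sub hAr.integral_prod_left hBr.integral_prod_left, hA0, zero_sub]
  simp_rw [hB1]

end ChainRule

/-! ### Dilated kernels and continuity of translations in `L¹`. -/

section Mollifier

variable {n : ℕ}

/-- The `L¹`-preserving dilation `κ_ε(z) = ε⁻ⁿ κ(z / ε)`. -/
def dilate (ε : ℝ) (κ : EuclideanSpace ℝ (Fin n) → ℝ) (z : EuclideanSpace ℝ (Fin n)) : ℝ :=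
  (ε⁻¹) ^ n * κ (ε⁻¹ • z)

lemma integral_dilate {ε : ℝ} (hε : 0 < ε) (κ : EuclideanSpace ℝ (Fin n) → ℝ) :
    ∫ z, dilate ε κ z = ∫ z, κ z := by
  simp only [dilate]
  rw [integral_const_mul, Measure.integral_comp_inv_smul, finrank_euclideanSpace_fin,
    abs_of_pos (by positivity), smul_eq_mul, ← mul_assoc, ← mul_pow, inv_mul_cancel₀ hε.ne',
    one_pow, one_mul]

lemma dilate_eq_zero {ε : ℝ} (hε : 0 < ε) {κ : EuclideanSpace ℝ (Fin n) → ℝ}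
    (hκ : ∀ z, 1 < ‖z‖ → κ z = 0) {z : EuclideanSpace ℝ (Fin n)} (hz : ε < ‖z‖) :
    dilate ε κ z = 0 := by
  rw [dilate, hκ, mul_zero]
  rw [norm_smul, norm_inv, Real.norm_of_nonneg hε.le, inv_mul_eq_div, one_lt_div hε]
  exact hz

lemma dilate_nonneg {ε : ℝ} (hε : 0 < ε) {κ : EuclideanSpace ℝ (Fin n) → ℝ}
    (hκ : ∀ z, 0 ≤ κ z) (z : EuclideanSpace ℝ (Fin n)) : 0 ≤ dilate ε κ z :=
  mul_nonneg (by positivity) (hκ _)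

lemma tendsto_eLpNorm_translate {u : EuclideanSpace ℝ (Fin n) → ℝ} (hu : Integrable u) :
    Tendsto (fun z => ∫⁻ x, ‖u (x - z) - u x‖ₑ) (𝓝 0) (𝓝 0) := by
  have h1top : Fact ((1 : ℝ≥0∞) ≠ ⊤) := ⟨ENNReal.one_ne_top⟩
  have hm : MemLp u 1 volume := memLp_one_iff_integrable.2 hu
  let f : Lp ℝ 1 (volume : Measure (EuclideanSpace ℝ (Fin n))) := hm.toLp u
  have hc : Continuous fun z : EuclideanSpace ℝ (Fin n) => DomAddAct.mk (-z) +ᵥ f := by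
    have : Continuous fun z : EuclideanSpace ℝ (Fin n) => DomAddAct.mk (-z) :=
      DomAddAct.continuous_mk.comp continuous_neg
    exact this.vadd continuous_const
  have h1 : Tendsto (fun z : EuclideanSpace ℝ (Fin n) => edist (DomAddAct.mk (-z) +ᵥ f) f)
      (𝓝 0) (𝓝 0) := by
    have h2 := (hc.edist (continuous_const (y := f))).tendsto 0
    simpa using h2
  refine h1.congr fun z => ?_
  rw [DomAddAct.mk_vadd_toLp, Lp.edist_toLp_toLp, eLpNorm_one_eq_lintegral_enorm]
  refine lintegral_congr fun x => ?_
  simp [sub_eq_neg_add]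

/-- The average oscillation of an integrable function at scale `ε` tends to zero. -/
lemma tendsto_lintegral_dilate_mul {u : EuclideanSpace ℝ (Fin n) → ℝ} (hum : Measurable u)
    (hu : Integrable u) {κ : EuclideanSpace ℝ (Fin n) → ℝ} (hκ : Integrable κ)
    (hκm : Measurable κ) (hκ0 : ∀ z, 0 ≤ κ z) (hκ1 : ∀ z, 1 < ‖z‖ → κ z = 0) :
    Tendsto (fun ε => ∫⁻ x, ∫⁻ z, ENNReal.ofReal (dilate ε κ z) * ‖u (x - z) - u x‖ₑ)
      (𝓝[>] 0) (𝓝 0) := by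
  -- The kernel mass does not depend on `ε`, so after Tonelli only the `L¹` modulus of continuity of
  -- `u` on `‖z‖ ≤ ε` matters.
  have hC : ∀ ε, 0 < ε → ∫⁻ z, ENNReal.ofReal (dilate ε κ z) = ENNReal.ofReal (∫ z, κ z) :=
    fun ε hε => by
      rw [← integral_dilate hε κ, ofReal_integral_eq_lintegral_ofReal]
      · exact (hκ.comp_smul (inv_ne_zero hε.ne')).const_mul _
      · exact Eventually.of_forall (dilate_nonneg hε hκ0)
  have hdm : ∀ ε, Measurable (dilate ε κ) := fun ε => by
    unfold dilate
    fun_prop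
  have hswap : ∀ ε, ∫⁻ x, ∫⁻ z, ENNReal.ofReal (dilate ε κ z) * ‖u (x - z) - u x‖ₑ =
      ∫⁻ z, ENNReal.ofReal (dilate ε κ z) * ∫⁻ x, ‖u (x - z) - u x‖ₑ := fun ε => by
    have := hdm ε
    rw [lintegral_lintegral_swap]
    · refine lintegral_congr fun z => ?_
      rw [lintegral_const_mul]
      fun_prop
    · refine Measurable.aemeasurable ?_
      have h1 : Measurable fun p : EuclideanSpace ℝ (Fin n) × EuclideanSpace ℝ (Fin n) =>
          ENNReal.ofReal (dilate ε κ p.2) * ‖u (p.1 - p.2) - u p.1‖ₑ := by fun_prop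
      exact h1
  rw [ENNReal.tendsto_nhds_zero]
  intro η hη
  obtain ⟨η', hη', hηC⟩ : ∃ η' : ℝ≥0∞, 0 < η' ∧ ENNReal.ofReal (∫ z, κ z) * η' ≤ η := by
    -- The `+ 1` covers a kernel of zero mass.
    refine ⟨η / (ENNReal.ofReal (∫ z, κ z) + 1), ENNReal.div_pos hη.ne' (by finiteness), ?_⟩
    rw [← mul_div_assoc]
    refine ENNReal.div_le_of_le_mul ?_
    rw [mul_comm]
    gcongr
    exact le_self_add
  have hev := (ENNReal.tendsto_nhds_zero.1 (tendsto_eLpNorm_translate hu)) η' hη'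
  obtain ⟨δ, hδ, hball⟩ := Metric.eventually_nhds_iff.1 hev
  filter_upwards [Ioo_mem_nhdsGT hδ] with ε hε
  rw [hswap]
  calc ∫⁻ z, ENNReal.ofReal (dilate ε κ z) * ∫⁻ x, ‖u (x - z) - u x‖ₑ
      ≤ ∫⁻ z, ENNReal.ofReal (dilate ε κ z) * η' := by
        refine lintegral_mono fun z => ?_
        by_cases hz : ε < ‖z‖
        · simp [dilate_eq_zero hε.1 hκ1 hz]
        · gcongr
          exact hball (by simpa using (not_lt.1 hz).trans_lt hε.2)
    _ = ENNReal.ofReal (∫ z, κ z) * η' := by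
        rw [lintegral_mul_const _ (hdm ε).ennreal_ofReal, hC ε hε.1]
    _ ≤ η := hηC

end Mollifier

/-! ### The standard mollifier. -/

section StandardMollifier

variable (n : ℕ)

/-- A smooth probability density on `ℝⁿ` supported in the unit ball. -/
def unitBump : EuclideanSpace ℝ (Fin n) → ℝ :=
  (⟨1 / 2, 1, by norm_num, by norm_num⟩ : ContDiffBump (0 : EuclideanSpace ℝ (Fin n))).normed volume

variable {n}

lemma contDiff_unitBump : ContDiff ℝ 1 (unitBump n) := ContDiffBump.contDiff_normed (n := 1) _

lemma unitBump_nonneg (z : EuclideanSpace ℝ (Fin n)) : 0 ≤ unitBump n z :=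
  ContDiffBump.nonneg_normed _ _

lemma integral_unitBump : ∫ z, unitBump n z = 1 := ContDiffBump.integral_normed _

lemma hasCompactSupport_unitBump : HasCompactSupport (unitBump n) :=
  ContDiffBump.hasCompactSupport_normed _

lemma tsupport_unitBump : tsupport (unitBump n) = Metric.closedBall 0 1 :=
  ContDiffBump.tsupport_normed_eq _

lemma unitBump_eq_zero {z : EuclideanSpace ℝ (Fin n)} (hz : 1 < ‖z‖) : unitBump n z = 0 := by
  refine image_eq_zero_of_notMem_tsupport ?_
  rw [tsupport_unitBump]
  simpa using hz

/-- The standard mollifier at scale `1 / (k + 1)`. -/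
def mollifier (n k : ℕ) : EuclideanSpace ℝ (Fin n) → ℝ :=
  dilate (1 / ((k : ℝ) + 1)) (unitBump n)

lemma scale_pos (k : ℕ) : 0 < 1 / ((k : ℝ) + 1) := by positivity

lemma tendsto_scale : Tendsto (fun k : ℕ => 1 / ((k : ℝ) + 1)) atTop (𝓝[>] 0) :=
  tendsto_nhdsWithin_iff.2 ⟨tendsto_one_div_add_atTop_nhds_zero_nat,
    Eventually.of_forall scale_pos⟩

variable (k : ℕ)

lemma contDiff_mollifier : ContDiff ℝ 1 (mollifier n k) := by
  unfold mollifier dilate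
  have := contDiff_unitBump (n := n)
  fun_prop

lemma continuous_mollifier : Continuous (mollifier n k) := (contDiff_mollifier k).continuous

lemma mollifier_nonneg (z : EuclideanSpace ℝ (Fin n)) : 0 ≤ mollifier n k z :=
  dilate_nonneg (scale_pos k) unitBump_nonneg z

lemma integral_mollifier : ∫ z, mollifier n k z = 1 := by
  rw [mollifier, integral_dilate (scale_pos k), integral_unitBump]

lemma mollifier_eq_zero {z : EuclideanSpace ℝ (Fin n)} (hz : 1 / ((k : ℝ) + 1) < ‖z‖) :
    mollifier n k z = 0 :=
  dilate_eq_zero (scale_pos k) (fun _ => unitBump_eq_zero) hz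

lemma tsupport_mollifier_subset :
    tsupport (mollifier n k) ⊆ Metric.closedBall 0 (1 / ((k : ℝ) + 1)) := by
  refine closure_minimal (fun z hz => ?_) Metric.isClosed_closedBall
  rw [mem_closedBall_zero_iff]
  by_contra h
  exact hz (mollifier_eq_zero k (not_le.1 h))

lemma hasCompactSupport_mollifier : HasCompactSupport (mollifier n k) :=
  (isCompact_closedBall _ _).of_isClosed_subset (isClosed_tsupport _) (tsupport_mollifier_subset k)

lemma integrable_mollifier : Integrable (mollifier n k) :=
  (continuous_mollifier k).integrable_of_hasCompactSupport (hasCompactSupport_mollifier k)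

lemma integral_mollifier_sub_left (x : EuclideanSpace ℝ (Fin n)) :
    ∫ y, mollifier n k (x - y) = 1 := by
  rw [integral_sub_left_eq_self (mollifier n k) volume x, integral_mollifier]

lemma integral_mollifier_sub_right (y : EuclideanSpace ℝ (Fin n)) :
    ∫ x, mollifier n k (x - y) = 1 := by
  rw [integral_sub_right_eq_self (mollifier n k) y, integral_mollifier]

/-- Differentiation costs a factor `ε⁻¹`, which `‖z‖` gives back, so the product is again an
`L¹`-preserving dilation of a fixed profile. This scaling drives the commutator estimate. -/
lemma norm_fderiv_mollifier_mul (z : EuclideanSpace ℝ (Fin n)) :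
    ‖fderiv ℝ (mollifier n k) z‖ * ‖z‖ =
      dilate (1 / ((k : ℝ) + 1)) (fun z => ‖fderiv ℝ (unitBump n) z‖ * ‖z‖) z := by
  have hε := scale_pos k
  set ε := 1 / ((k : ℝ) + 1)
  have h1 : HasFDerivAt (mollifier n k)
      (((ε⁻¹) ^ n) • (fderiv ℝ (unitBump n) (ε⁻¹ • z)).comp
        (ε⁻¹ • ContinuousLinearMap.id ℝ (EuclideanSpace ℝ (Fin n)))) z :=
    (((contDiff_unitBump.differentiable one_ne_zero (ε⁻¹ • z)).hasFDerivAt.comp z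
      ((hasFDerivAt_id z).const_smul ε⁻¹)).const_mul _)
  rw [h1.fderiv, ContinuousLinearMap.comp_smul, ContinuousLinearMap.comp_id, norm_smul, norm_smul,
    dilate, norm_smul, Real.norm_of_nonneg (by positivity), Real.norm_of_nonneg (by positivity)]
  ring

/-- The mollification `u_k = u * ρ_k`. -/
def mollify (u : EuclideanSpace ℝ (Fin n) → ℝ) (k : ℕ) : EuclideanSpace ℝ (Fin n) → ℝ :=
  convolution u (mollifier n k) (ContinuousLinearMap.mul ℝ ℝ) volume

variable {u : EuclideanSpace ℝ (Fin n) → ℝ}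

lemma contDiff_mollify (hu : Integrable u) : ContDiff ℝ 1 (mollify u k) :=
  (hasCompactSupport_mollifier k).contDiff_convolution_right (n := 1) _ hu.locallyIntegrable
    (contDiff_mollifier k)

lemma integrable_mollify (hu : Integrable u) : Integrable (mollify u k) :=
  hu.integrable_convolution _ (integrable_mollifier k)

lemma fderiv_mollify_apply (hu : Integrable u) (x v : EuclideanSpace ℝ (Fin n)) :
    fderiv ℝ (mollify u k) x v = ∫ y, u y * fderiv ℝ (mollifier n k) (x - y) v := by
  rw [mollify, ((hasCompactSupport_mollifier k).hasFDerivAt_convolution_right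
    (ContinuousLinearMap.mul ℝ ℝ) hu.locallyIntegrable (contDiff_mollifier k) x).fderiv,
    convolution_precompR_apply _ hu.locallyIntegrable ((hasCompactSupport_mollifier k).fderiv ℝ)
      ((contDiff_mollifier k).continuous_fderiv one_ne_zero)]
  rfl

omit k in
/-- Kernels that are dominated by dilations of a fixed profile and act on the increments of `u`
yield functions that are small in `L¹`. -/
lemma tendsto_lintegral_of_kernel_le (hum : Measurable u) (hu : Integrable u)
    {κ : EuclideanSpace ℝ (Fin n) → ℝ} (hκ : Integrable κ)
    (hκm : Measurable κ) (hκ0 : ∀ z, 0 ≤ κ z) (hκ1 : ∀ z, 1 < ‖z‖ → κ z = 0)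
    {q : ℕ → EuclideanSpace ℝ (Fin n) → EuclideanSpace ℝ (Fin n) → ℝ}
    (hq : ∀ k x y, |q k x y| ≤ dilate (1 / ((k : ℝ) + 1)) κ (x - y)) :
    Tendsto (fun k => ∫⁻ x, ‖∫ y, (u y - u x) * q k x y‖ₑ) atTop (𝓝 0) := by
  refine tendsto_of_tendsto_of_tendsto_of_le_of_le tendsto_const_nhds
    ((tendsto_lintegral_dilate_mul hum hu hκ hκm hκ0 hκ1).comp tendsto_scale)
    (fun _ => zero_le) fun k => ?_
  refine lintegral_mono fun x => ?_
  refine (enorm_integral_le_lintegral_enorm _).trans ?_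
  rw [← lintegral_sub_left_eq_self _ x]
  refine lintegral_mono fun z => ?_
  rw [enorm_mul, mul_comm]
  gcongr
  rw [← ofReal_norm, Real.norm_eq_abs]
  refine ENNReal.ofReal_le_ofReal ((hq k x (x - z)).trans ?_)
  rw [sub_sub_cancel]

omit k in
-- Since `ρ_k` has mass `1`, `u_k - u` is an average of increments of `u`, to which the kernel
-- estimate applies.
lemma tendsto_integral_abs_mollify_sub (hum : Measurable u) (hu : Integrable u) :
    Tendsto (fun k => ∫ x, |mollify u k x - u x|) atTop (𝓝 0) := by
  have h := tendsto_lintegral_of_kernel_le hum hu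
    (contDiff_unitBump.continuous.integrable_of_hasCompactSupport hasCompactSupport_unitBump)
    contDiff_unitBump.continuous.measurable unitBump_nonneg (fun z => unitBump_eq_zero)
    (q := fun k x y => mollifier n k (x - y))
    (fun k x y => by rw [abs_of_nonneg (mollifier_nonneg k _)]; rfl)
  have h2 : ∀ k x, ∫ y, (u y - u x) * mollifier n k (x - y) = mollify u k x - u x :=
    fun k x => by
      have h3 : Integrable fun y => mollifier n k (x - y) :=
        (integrable_mollifier k).comp_sub_left x
      have h4 : Integrable fun y => u y * mollifier n k (x - y) :=
        (hasCompactSupport_mollifier k).convolutionExists_right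
          (ContinuousLinearMap.mul ℝ ℝ) hu.locallyIntegrable (continuous_mollifier k) x
      simp_rw [sub_mul]
      rw [integral_sub h4 (h3.const_mul _), integral_const_mul, integral_mollifier_sub_left,
        mul_one]
      rfl
  simp_rw [h2] at h
  have h5 : ∀ k, ∫ x, |mollify u k x - u x| = (∫⁻ x, ‖mollify u k x - u x‖ₑ).toReal :=
    fun k => integral_norm_eq_lintegral_enorm
      (((contDiff_mollify k hu).continuous.measurable.sub hum).aestronglyMeasurable)
  simp_rw [h5]
  have h6 := (ENNReal.tendsto_toReal ENNReal.zero_ne_top).comp h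
  rw [ENNReal.toReal_zero] at h6
  exact h6

end StandardMollifier

/-! ### Friedrichs' commutator of mollification and differentiation. -/

section Friedrichs

variable {n : ℕ}

/-- The mollification `D * ρ_k` of a signed measure. -/
def mollifyMeasure (D : SignedMeasure (EuclideanSpace ℝ (Fin n))) (k : ℕ)
    (x : EuclideanSpace ℝ (Fin n)) : ℝ :=
  ∫ᵛ y, mollifier n k (x - y) ∂•D

/-- The kernel of the commutator of mollification and differentiation along `X`. -/
def commKernel (X : EuclideanSpace ℝ (Fin n) → EuclideanSpace ℝ (Fin n)) (k : ℕ)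
    (x y : EuclideanSpace ℝ (Fin n)) : ℝ :=
  mollifier n k (x - y) * divergence X y - fderiv ℝ (mollifier n k) (x - y) (X y - X x)

lemma hasFDerivAt_mollifier_sub (k : ℕ) (x y : EuclideanSpace ℝ (Fin n)) :
    HasFDerivAt (fun y => mollifier n k (x - y)) (-fderiv ℝ (mollifier n k) (x - y)) y := by
  have h := ((contDiff_mollifier k).differentiable one_ne_zero (x - y)).hasFDerivAt.comp y
    ((hasFDerivAt_id y).const_sub x)
  simpa [Function.comp_def] using h

lemma hasCompactSupport_mollifier_sub (k : ℕ) (x : EuclideanSpace ℝ (Fin n)) :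
    HasCompactSupport fun y => mollifier n k (x - y) :=
  (hasCompactSupport_mollifier k).comp_homeomorph (Homeomorph.subLeft x)

lemma tsupport_mollifier_sub_subset (k : ℕ) (x : EuclideanSpace ℝ (Fin n)) :
    tsupport (fun y => mollifier n k (x - y)) ⊆ Metric.closedBall x (1 / ((k : ℝ) + 1)) := by
  refine closure_minimal (fun y hy => ?_) Metric.isClosed_closedBall
  by_contra h
  refine hy (mollifier_eq_zero k ?_)
  rw [← dist_eq_norm, dist_comm]
  exact not_le.1 h

variable {X : EuclideanSpace ℝ (Fin n) → EuclideanSpace ℝ (Fin n)}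

lemma continuous_commKernel (hX : ContDiff ℝ 1 X) (k : ℕ) (x : EuclideanSpace ℝ (Fin n)) :
    Continuous (commKernel X k x) := by
  have h1 := continuous_mollifier (n := n) k
  have h2 := continuous_divergence hX
  have h3 := (contDiff_mollifier (n := n) k).continuous_fderiv one_ne_zero
  have h4 := hX.continuous
  unfold commKernel
  fun_prop

/-- An exact divergence in `y` has zero integral; this is what allows `u y` to be replaced by `u y -
u x` in the commutator. -/
lemma commKernel_eq_divergence (hX : ContDiff ℝ 1 X) (k : ℕ)
    (x y : EuclideanSpace ℝ (Fin n)) :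
    commKernel X k x y = divergence (fun y => mollifier n k (x - y) • (X y - X x)) y := by
  have hXd := hX.differentiable one_ne_zero y
  have h := hasFDerivAt_mollifier_sub k x y
  rw [divergence_smul h.differentiableAt (hXd.sub_const _), h.fderiv,
    divergence_sub hXd (differentiableAt_const _), divergence_const, sub_zero, commKernel]
  simp only [neg_apply]
  ring

lemma contDiff_mollifier_sub_smul (hX : ContDiff ℝ 1 X) (k : ℕ)
    (x : EuclideanSpace ℝ (Fin n)) :
    ContDiff ℝ 1 fun y => mollifier n k (x - y) • (X y - X x) := by
  have := contDiff_mollifier (n := n) k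
  fun_prop

lemma hasCompactSupport_mollifier_sub_smul (k : ℕ) (x : EuclideanSpace ℝ (Fin n)) :
    HasCompactSupport fun y => mollifier n k (x - y) • (X y - X x) :=
  (hasCompactSupport_mollifier_sub k x).mono fun y hy h0 => hy (by
    change mollifier n k (x - y) • (X y - X x) = 0
    rw [show mollifier n k (x - y) = 0 from h0, zero_smul])

lemma integral_commKernel (hX : ContDiff ℝ 1 X) (k : ℕ) (x : EuclideanSpace ℝ (Fin n)) :
    ∫ y, commKernel X k x y = 0 := by
  simp_rw [commKernel_eq_divergence hX]
  exact integral_divergence_eq_zero volume (contDiff_mollifier_sub_smul hX k x)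
    (hasCompactSupport_mollifier_sub_smul k x)

lemma hasCompactSupport_commKernel (hX : ContDiff ℝ 1 X) (k : ℕ)
    (x : EuclideanSpace ℝ (Fin n)) : HasCompactSupport (commKernel X k x) := by
  rw [show commKernel X k x = divergence (fun y => mollifier n k (x - y) • (X y - X x)) from
    funext (commKernel_eq_divergence hX k x)]
  exact hasCompactSupport_divergence (hasCompactSupport_mollifier_sub_smul k x)

/-- The Lipschitz bound on `X y - X x` supplies the factor `‖x - y‖` that compensates the singular
derivative of `ρ_k`; the other term uses that the divergence of `X` is bounded. Compact support
makes both bounds global. -/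
lemma exists_commKernel_bound (hX : ContDiff ℝ 1 X) (hXc : HasCompactSupport X) :
    ∃ κ : EuclideanSpace ℝ (Fin n) → ℝ, Integrable κ ∧ Measurable κ ∧ (∀ z, 0 ≤ κ z) ∧
      (∀ z, 1 < ‖z‖ → κ z = 0) ∧
      ∀ k x y, |commKernel X k x y| ≤ dilate (1 / ((k : ℝ) + 1)) κ (x - y) := by
  obtain ⟨L, hL⟩ := hX.lipschitzWith_of_hasCompactSupport hXc one_ne_zero
  obtain ⟨M, hM⟩ := (continuous_divergence hX).bounded_above_of_compact_support
    (hasCompactSupport_divergence hXc)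
  have hM0 : 0 ≤ M := (norm_nonneg _).trans (hM 0)
  let κ : EuclideanSpace ℝ (Fin n) → ℝ := fun z =>
    M * unitBump n z + L * (‖fderiv ℝ (unitBump n) z‖ * ‖z‖)
  have hd : Continuous (fderiv ℝ (unitBump n)) := contDiff_unitBump.continuous_fderiv one_ne_zero
  have hb : Continuous (unitBump n) := contDiff_unitBump.continuous
  have hκ : Continuous κ := by fun_prop
  have hz : ∀ z : EuclideanSpace ℝ (Fin n), 1 < ‖z‖ → κ z = 0 := fun z hz => by
    have h1 : fderiv ℝ (unitBump n) z = 0 := by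
      refine image_eq_zero_of_notMem_tsupport fun h => ?_
      have := tsupport_fderiv_subset ℝ h
      rw [tsupport_unitBump, mem_closedBall_zero_iff] at this
      linarith
    simp only [κ, unitBump_eq_zero hz, h1]
    simp
  have hκc : HasCompactSupport κ := by
    refine HasCompactSupport.of_support_subset_isCompact
      (isCompact_closedBall (0 : EuclideanSpace ℝ (Fin n)) 1) fun z hz' => ?_
    rw [mem_closedBall_zero_iff]
    by_contra h
    exact hz' (hz z (not_le.1 h))
  refine ⟨κ, hκ.integrable_of_hasCompactSupport hκc, hκ.measurable, fun z => ?_, hz,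
    fun k x y => ?_⟩
  · have := unitBump_nonneg z
    positivity
  · have h1 : dilate (1 / ((k : ℝ) + 1)) κ (x - y) =
        M * mollifier n k (x - y) + L * (‖fderiv ℝ (mollifier n k) (x - y)‖ * ‖x - y‖) := by
      rw [norm_fderiv_mollifier_mul]
      simp only [dilate, κ, mollifier]
      ring
    rw [h1, commKernel]
    refine (abs_sub _ _).trans (add_le_add ?_ ?_)
    · rw [abs_mul, abs_of_nonneg (mollifier_nonneg k _), mul_comm]
      exact mul_le_mul_of_nonneg_right (hM y) (mollifier_nonneg k _)
    · rw [← Real.norm_eq_abs]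
      refine (ContinuousLinearMap.le_opNorm _ _).trans ?_
      have h2 : ‖X y - X x‖ ≤ L * ‖x - y‖ := by
        rw [norm_sub_rev x y]
        simpa [dist_eq_norm] using hL.dist_le_mul y x
      calc _ ≤ ‖fderiv ℝ (mollifier n k) (x - y)‖ * (L * ‖x - y‖) := by gcongr
        _ = _ := by ring

variable {Ω : Set (EuclideanSpace ℝ (Fin n))} {u : EuclideanSpace ℝ (Fin n) → ℝ}
  {D : SignedMeasure (EuclideanSpace ℝ (Fin n))}

lemma integrable_mul_of_continuous (hu : Integrable u) {g : EuclideanSpace ℝ (Fin n) → ℝ}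
    (hg : Continuous g) (hc : HasCompactSupport g) : Integrable fun y => u y * g y := by
  obtain ⟨C, hC⟩ := hg.bounded_above_of_compact_support hc
  exact hu.mul_bdd hg.aestronglyMeasurable (Eventually.of_forall hC)

/-- Friedrichs' commutator identity. -/
lemma fderiv_mollify_sub_mollifyMeasure (hX : ContDiff ℝ 1 X) (hu : Integrable u)
    (hu0 : ∀ x ∉ Ω, u x = 0) (hD : HasWeakDeriv X Ω u D) {k : ℕ}
    {x : EuclideanSpace ℝ (Fin n)} (hx : Metric.closedBall x (1 / ((k : ℝ) + 1)) ⊆ Ω) :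
    fderiv ℝ (mollify u k) x (X x) - mollifyMeasure D k x =
      ∫ y, (u y - u x) * commKernel X k x y := by
  have hψ : ContDiff ℝ 1 fun y => mollifier n k (x - y) := by
    have := contDiff_mollifier (n := n) k
    fun_prop
  have hψc := hasCompactSupport_mollifier_sub (n := n) k x
  have h1 := hD _ hψ hψc ((tsupport_mollifier_sub_subset k x).trans hx)
  rw [setIntegral_eq_integral_of_forall_compl_eq_zero
    (fun y hy => by rw [hu0 y hy, zero_mul])] at h1
  have hdc : Continuous fun y => fderiv ℝ (mollifier n k) (x - y) (X x) := by
    have h3 := (contDiff_mollifier (n := n) k).continuous_fderiv one_ne_zero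
    fun_prop
  have hdcs : HasCompactSupport fun y => fderiv ℝ (mollifier n k) (x - y) (X x) :=
    ((hasCompactSupport_mollifier k).fderiv_apply ℝ (X x)).comp_homeomorph (Homeomorph.subLeft x)
  have hVc : HasCompactSupport fun y => mollifier n k (x - y) • X y :=
    hψc.mono fun y hy h0 => hy (by
      change mollifier n k (x - y) • X y = 0
      rw [show mollifier n k (x - y) = 0 from h0, zero_smul])
  have hVd : ContDiff ℝ 1 fun y => mollifier n k (x - y) • X y := hψ.smul hX
  -- The first term, with `X` frozen at `x`, yields `X u_k`; the second yields `-(D * ρ_k)` by the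
  -- weak derivative tested with `ρ_k (x - ·)`.
  have hsplit : ∀ y, commKernel X k x y = fderiv ℝ (mollifier n k) (x - y) (X x) +
      divergence (fun y => mollifier n k (x - y) • X y) y := fun y => by
    have h := hasFDerivAt_mollifier_sub k x y
    rw [divergence_smul h.differentiableAt (hX.differentiable one_ne_zero y), h.fderiv,
      commKernel, map_sub]
    simp only [neg_apply]
    ring
  rw [mollifyMeasure, h1, fderiv_mollify_apply k hu, sub_neg_eq_add, ← integral_add
    (integrable_mul_of_continuous hu hdc hdcs)
    (integrable_mul_of_continuous hu (continuous_divergence hVd)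
      (hasCompactSupport_divergence hVc))]
  have hqi : Integrable (commKernel X k x) :=
    (continuous_commKernel hX k x).integrable_of_hasCompactSupport
      (hasCompactSupport_commKernel hX k x)
  simp_rw [sub_mul]
  rw [integral_sub (integrable_mul_of_continuous hu (continuous_commKernel hX k x)
    (hasCompactSupport_commKernel hX k x)) (hqi.const_mul _), integral_const_mul,
    integral_commKernel hX, mul_zero, sub_zero]
  refine integral_congr_ae (Eventually.of_forall fun y => ?_)
  simp only [hsplit, mul_add]

end Friedrichs

/-! ### Derivatives of the subgraph as limits of graph averages. -/

section GraphAverage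

variable {n : ℕ} {Ω : Set (EuclideanSpace ℝ (Fin n))} {u : EuclideanSpace ℝ (Fin n) → ℝ}

lemma eventually_closedBall_subset {K : Set (EuclideanSpace ℝ (Fin n))} (hK : IsCompact K)
    (hΩ : IsOpen Ω) (hKΩ : K ⊆ Ω) :
    ∀ᶠ k : ℕ in atTop, ∀ x ∈ K, Metric.closedBall x (1 / ((k : ℝ) + 1)) ⊆ Ω := by
  obtain ⟨δ, hδ, h⟩ := hK.exists_cthickening_subset_open hΩ hKΩ
  have h1 : ∀ᶠ k : ℕ in atTop, 1 / ((k : ℝ) + 1) < δ :=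
    (tendsto_order.1 (tendsto_one_div_add_atTop_nhds_zero_nat (𝕜 := ℝ))).2 δ hδ
  filter_upwards [h1] with k hk x hx
  exact (Metric.closedBall_subset_closedBall hk.le).trans
    ((Metric.closedBall_subset_cthickening hx δ).trans h)

lemma exists_mollifier_le (k : ℕ) : ∃ C, ∀ z, ‖mollifier n k z‖ ≤ C :=
  (continuous_mollifier k).bounded_above_of_compact_support (hasCompactSupport_mollifier k)

lemma continuous_mollifyMeasure (D : SignedMeasure (EuclideanSpace ℝ (Fin n))) (k : ℕ) :
    Continuous (mollifyMeasure D k) := by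
  obtain ⟨C, hC⟩ := exists_mollifier_le (n := n) k
  have hc := continuous_mollifier (n := n) k
  refine VectorMeasure.continuous_of_dominated (bound := fun _ => C) (fun x => ?_)
    (fun x => Eventually.of_forall fun y => hC _) (integrable_const _)
    (Eventually.of_forall fun y => by fun_prop)
  exact (by fun_prop : Continuous fun y => mollifier n k (x - y)).aestronglyMeasurable

lemma integrable_mul_mollifier_sub {g : EuclideanSpace ℝ (Fin n) → ℝ} (hg : Integrable g)
    (μ : Measure (EuclideanSpace ℝ (Fin n))) [IsFiniteMeasure μ] (k : ℕ) :
    Integrable (fun p : EuclideanSpace ℝ (Fin n) × EuclideanSpace ℝ (Fin n) =>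
      g p.1 * mollifier n k (p.1 - p.2)) (volume.prod μ) := by
  obtain ⟨C, hC⟩ := exists_mollifier_le (n := n) k
  have hc := continuous_mollifier (n := n) k
  have h1 : Integrable (fun p : EuclideanSpace ℝ (Fin n) × EuclideanSpace ℝ (Fin n) => g p.1)
      (volume.prod μ) := by
    simpa using hg.mul_prod (integrable_const (1 : ℝ) (μ := μ))
  exact h1.mul_bdd (by fun_prop : Continuous fun p : EuclideanSpace ℝ (Fin n) ×
    EuclideanSpace ℝ (Fin n) => mollifier n k (p.1 - p.2)).aestronglyMeasurable
    (Eventually.of_forall fun p => hC _)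

lemma continuous_integral_mul_mollifier_sub {g : EuclideanSpace ℝ (Fin n) → ℝ} (hg : Integrable g)
    (k : ℕ) : Continuous fun y => ∫ x, g x * mollifier n k (x - y) := by
  obtain ⟨C, hC⟩ := exists_mollifier_le (n := n) k
  have hc := continuous_mollifier (n := n) k
  refine continuous_of_dominated (bound := fun x => |g x| * C) (fun y => ?_)
    (fun y => Eventually.of_forall fun x => ?_) (hg.abs.mul_const C)
    (Eventually.of_forall fun x => by fun_prop)
  · exact hg.aestronglyMeasurable.mul
      (by fun_prop : Continuous fun x => mollifier n k (x - y)).aestronglyMeasurable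
  · rw [norm_mul, Real.norm_eq_abs (g x)]
    gcongr
    exact hC _

lemma abs_integral_mul_mollifier_sub_le {g : EuclideanSpace ℝ (Fin n) → ℝ} {C : ℝ}
    (hC : ∀ x, |g x| ≤ C) (k : ℕ) (y : EuclideanSpace ℝ (Fin n)) :
    |∫ x, g x * mollifier n k (x - y)| ≤ C := by
  have h := norm_integral_le_of_norm_le (f := fun x => g x * mollifier n k (x - y))
    (((integrable_mollifier k).comp_sub_right y).const_mul C)
    (Eventually.of_forall fun x => by
      rw [norm_mul, Real.norm_of_nonneg (mollifier_nonneg k _)]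
      exact mul_le_mul_of_nonneg_right (hC x) (mollifier_nonneg k _))
  rwa [integral_const_mul, integral_mollifier_sub_right, mul_one, Real.norm_eq_abs] at h

/-- Fubini on each Jordan part moves the mollification from `D` to the test function. -/
lemma integral_mul_mollifyMeasure (D : SignedMeasure (EuclideanSpace ℝ (Fin n)))
    {g : EuclideanSpace ℝ (Fin n) → ℝ} (hg : Integrable g) {C : ℝ} (hC : ∀ x, |g x| ≤ C)
    (k : ℕ) :
    ∫ x, g x * mollifyMeasure D k x = ∫ᵛ y, (∫ x, g x * mollifier n k (x - y)) ∂•D := by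
  obtain ⟨M, hM⟩ := exists_mollifier_le (n := n) k
  have hc := continuous_mollifier (n := n) k
  have hint : ∀ x, Integrable (fun y => mollifier n k (x - y)) D.variation := fun x =>
    Integrable.of_bound (by fun_prop : Continuous fun y => mollifier n k
      (x - y)).aestronglyMeasurable M (Eventually.of_forall fun y => hM _)
  have hint2 : Integrable (fun y => ∫ x, g x * mollifier n k (x - y)) D.variation :=
    Integrable.of_bound (continuous_integral_mul_mollifier_sub hg k).aestronglyMeasurable C
      (Eventually.of_forall (abs_integral_mul_mollifier_sub_le hC k))
  have hpos := integrable_mul_mollifier_sub hg D.toJordanDecomposition.posPart k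
  have hneg := integrable_mul_mollifier_sub hg D.toJordanDecomposition.negPart k
  rw [integral_signedMeasure_eq_sub D hint2]
  simp_rw [mollifyMeasure, integral_signedMeasure_eq_sub D (hint _), mul_sub,
    ← integral_const_mul]
  rw [integral_sub hpos.integral_prod_left hneg.integral_prod_left,
    integral_integral_swap (f := fun x y => g x * mollifier n k (x - y)) hpos,
    integral_integral_swap (f := fun x y => g x * mollifier n k (x - y)) hneg]

/-- The averages `y ↦ ∫ f (x, u_k x) ρ_k (x - y) dx` of a function over the graph of the
mollification `u_k`. -/
def graphAvg (u : EuclideanSpace ℝ (Fin n) → ℝ) (k : ℕ)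
    (f : EuclideanSpace ℝ (Fin n) × ℝ → ℝ) (y : EuclideanSpace ℝ (Fin n)) : ℝ :=
  ∫ x, f (x, mollify u k x) * mollifier n k (x - y)

variable {f : EuclideanSpace ℝ (Fin n) × ℝ → ℝ}

lemma hasCompactSupport_comp_graph {β : Type*} [Zero β]
    {f : EuclideanSpace ℝ (Fin n) × ℝ → β} (hf : HasCompactSupport f)
    (v : EuclideanSpace ℝ (Fin n) → ℝ) : HasCompactSupport fun x => f (x, v x) := by
  refine HasCompactSupport.of_support_subset_isCompact (hf.image continuous_fst) fun x hx => ?_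
  exact ⟨(x, v x), subset_tsupport _ hx, rfl⟩

lemma continuous_comp_graph (hu : Integrable u) (hf : Continuous f) (k : ℕ) :
    Continuous fun x => f (x, mollify u k x) := by
  have := (contDiff_mollify k hu).continuous
  fun_prop

lemma integrable_comp_graph (hu : Integrable u) (hf : Continuous f) (hfc : HasCompactSupport f)
    (k : ℕ) : Integrable fun x => f (x, mollify u k x) :=
  (continuous_comp_graph hu hf k).integrable_of_hasCompactSupport
    (hasCompactSupport_comp_graph hfc _)

/-- The derivative of the subgraph along `(X, 0)` as a limit of graph averages. -/
lemma tendsto_integral_graphAvg {X : EuclideanSpace ℝ (Fin n) → EuclideanSpace ℝ (Fin n)}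
    (hX : ContDiff ℝ 1 X) (hXc : HasCompactSupport X) (hΩ : IsOpen Ω) (hum : Measurable u)
    (hu : Integrable u) (hu0 : ∀ x ∉ Ω, u x = 0)
    {D : SignedMeasure (EuclideanSpace ℝ (Fin n))} (hD : HasWeakDeriv X Ω u D)
    {φ : EuclideanSpace ℝ (Fin n) × ℝ → ℝ} (hφ : ContDiff ℝ 1 φ) (hc : HasCompactSupport φ)
    (ht : tsupport φ ⊆ Ω ×ˢ univ) :
    Tendsto (fun k => ∫ᵛ y, graphAvg u k φ y ∂•D) atTop
      (𝓝 (-∫ x, ∫ t in Iio (u x),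
        (φ (x, t) * divergence X x + fderiv ℝ φ (x, t) (X x, 0)))) := by
  obtain ⟨C, hC⟩ := hφ.continuous.bounded_above_of_compact_support hc
  have hφi := fun k => integrable_comp_graph hu hφ.continuous hc k
  have hφcs := fun k => hasCompactSupport_comp_graph hc (mollify u k)
  have hφcont := fun k => continuous_comp_graph hu hφ.continuous k
  -- the smooth approximations
  have hdX := continuous_divergence hX
  have hXcont := hX.continuous
  have hφ' := hφ.continuous_fderiv one_ne_zero
  have hφcont' := hφ.continuous
  have hG : Continuous fun p : EuclideanSpace ℝ (Fin n) × ℝ =>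
      φ p * divergence X p.1 + fderiv ℝ φ p (X p.1, 0) := by fun_prop
  have hGc : HasCompactSupport fun p : EuclideanSpace ℝ (Fin n) × ℝ =>
      φ p * divergence X p.1 + fderiv ℝ φ p (X p.1, 0) := by
    refine hc.mul_right.add ((hc.fderiv ℝ).mono fun p hp h0 => hp ?_)
    simp only [h0, zero_apply]
  have h1 := (tendsto_integral_setIntegral_Iio hum hu
    (fun k => (contDiff_mollify k hu).continuous.measurable) (fun k => integrable_mollify k hu)
    (tendsto_integral_abs_mollify_sub hum hu) hG hGc).neg
  have h2 : ∀ k, -∫ x, ∫ t in Iio (mollify u k x),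
      (φ (x, t) * divergence X x + fderiv ℝ φ (x, t) (X x, 0)) =
        ∫ x, φ (x, mollify u k x) * fderiv ℝ (mollify u k) x (X x) := fun k => by
    rw [integral_Iio_divergence_eq (contDiff_mollify k hu) hX hφ hc, neg_neg]
  -- the commutator
  obtain ⟨κ, hκi, hκm, hκ0, hκ1, hκ⟩ := exists_commKernel_bound hX hXc
  have h3 := tendsto_lintegral_of_kernel_le hum hu hκi hκm hκ0 hκ1 hκ
  have hK : IsCompact (Prod.fst '' tsupport φ) := hc.image continuous_fst
  have hKΩ : Prod.fst '' tsupport φ ⊆ Ω := by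
    rintro _ ⟨p, hp, rfl⟩
    exact (ht hp).1
  -- Replaces `X u_k` by `D * ρ_k`. The commutator identity is needed only on the projected support
  -- of `φ`, whose small balls lie in `Ω` for large `k`.
  have h4 : Tendsto (fun k => (∫ x, φ (x, mollify u k x) * fderiv ℝ (mollify u k) x (X x)) -
      ∫ x, φ (x, mollify u k x) * mollifyMeasure D k x) atTop (𝓝 0) := by
    rw [tendsto_zero_iff_enorm_tendsto_zero]
    have h5 : Tendsto (fun k => ENNReal.ofReal C *
        ∫⁻ x, ‖∫ y, (u y - u x) * commKernel X k x y‖ₑ) atTop (𝓝 0) := by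
      simpa using ENNReal.Tendsto.const_mul h3 (Or.inr ENNReal.ofReal_ne_top)
    refine tendsto_of_tendsto_of_tendsto_of_le_of_le' tendsto_const_nhds h5
      (Eventually.of_forall fun _ => zero_le) ?_
    filter_upwards [eventually_closedBall_subset hK hΩ hKΩ] with k hk
    have hu' := (contDiff_mollify k hu).continuous_fderiv one_ne_zero
    have hσ := continuous_mollifyMeasure D k
    have hφk := hφcont k
    rw [← integral_sub, ← lintegral_const_mul' _ _ ENNReal.ofReal_ne_top]
    · refine (enorm_integral_le_lintegral_enorm _).trans (lintegral_mono fun x => ?_)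
      rw [← mul_sub, enorm_mul]
      by_cases hx : x ∈ Prod.fst '' tsupport φ
      · rw [fderiv_mollify_sub_mollifyMeasure hX hu hu0 hD (hk x hx)]
        gcongr
        rw [← ofReal_norm]
        exact ENNReal.ofReal_le_ofReal (hC _)
      · have : φ (x, mollify u k x) = 0 := by
          by_contra hne
          exact hx ⟨_, subset_tsupport _ hne, rfl⟩
        simp [this]
    · exact (hφk.mul (hu'.clm_apply hXcont)).integrable_of_hasCompactSupport (hφcs k).mul_right
    · exact (hφk.mul hσ).integrable_of_hasCompactSupport (hφcs k).mul_right
  have h6 := (h1.congr h2).sub h4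
  rw [sub_zero] at h6
  refine h6.congr fun k => ?_
  rw [sub_sub_cancel, integral_mul_mollifyMeasure D (hφi k) (fun x => hC _)]
  rfl

/-- Writing the vertical density `-1` as a mollified measure makes the last component a limit of the
same graph averages as the others. -/
lemma mollifyMeasure_neg_lebesgueSigned (hΩb : Bornology.IsBounded Ω) {k : ℕ}
    {x : EuclideanSpace ℝ (Fin n)} (hx : Metric.closedBall x (1 / ((k : ℝ) + 1)) ⊆ Ω) :
    mollifyMeasure (-lebesgueSigned Ω hΩb) k x = -1 := by
  have : IsFiniteMeasure ((volume : Measure (EuclideanSpace ℝ (Fin n))).restrict Ω) :=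
    ⟨by simpa using hΩb.measure_lt_top⟩
  rw [mollifyMeasure, VectorMeasure.integral_neg_vectorMeasure, lebesgueSigned,
    integral_toSignedMeasure_lsmul, setIntegral_eq_integral_of_forall_compl_eq_zero,
    integral_mollifier_sub_left]
  intro y hy
  by_contra hne
  exact hy (hx (tsupport_mollifier_sub_subset k x (subset_tsupport _ hne)))

/-- The vertical derivative of the subgraph as a limit of graph averages. -/
lemma tendsto_integral_graphAvg_vertical (hΩ : IsOpen Ω) (hΩb : Bornology.IsBounded Ω)
    (hum : Measurable u) (hu : Integrable u)
    {φ : EuclideanSpace ℝ (Fin n) × ℝ → ℝ} (hφ : ContDiff ℝ 1 φ) (hc : HasCompactSupport φ)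
    (ht : tsupport φ ⊆ Ω ×ˢ univ) :
    Tendsto (fun k => ∫ᵛ y, graphAvg u k φ y ∂•(-lebesgueSigned Ω hΩb)) atTop
      (𝓝 (-∫ x, ∫ t in Iio (u x), fderiv ℝ φ (x, t) (0, 1))) := by
  obtain ⟨C, hC⟩ := hφ.continuous.bounded_above_of_compact_support hc
  have hK : IsCompact (Prod.fst '' tsupport φ) := hc.image continuous_fst
  have hKΩ : Prod.fst '' tsupport φ ⊆ Ω := by
    rintro _ ⟨p, hp, rfl⟩
    exact (ht hp).1
  have hG : Continuous fun p => fderiv ℝ φ p (0, 1) :=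
    (hφ.continuous_fderiv one_ne_zero).clm_apply continuous_const
  have h1 := (tendsto_integral_setIntegral_Iio hum hu
    (fun k => (contDiff_mollify k hu).continuous.measurable) (fun k => integrable_mollify k hu)
    (tendsto_integral_abs_mollify_sub hum hu) hG (hc.fderiv_apply ℝ (0, 1))).neg
  refine h1.congr' ?_
  filter_upwards [eventually_closedBall_subset hK hΩ hKΩ] with k hk
  simp only [graphAvg]
  rw [← integral_mul_mollifyMeasure _ (integrable_comp_graph hu hφ.continuous hc k)
    (fun x => hC _), ← integral_neg]
  refine integral_congr_ae (Eventually.of_forall fun x => ?_)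
  simp only
  rw [integral_Iio_fderiv_vertical hφ hc]
  by_cases hx : x ∈ Prod.fst '' tsupport φ
  · rw [mollifyMeasure_neg_lebesgueSigned hΩb (hk x hx), mul_neg_one]
  · have : φ (x, mollify u k x) = 0 := by
      by_contra hne
      exact hx ⟨_, subset_tsupport _ hne, rfl⟩
    simp [this]

end GraphAverage

/-! ### Existence of limit measures. -/

section VagueLimit

open scoped CompactlySupported

/-- A sequence of uniformly bounded positive functionals on compactly supported functions
converges, along an ultrafilter, to the integral against a finite measure. -/
lemma exists_measure_tendsto_hyperfilter {E : Type*} [TopologicalSpace E] [T2Space E]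
    [LocallyCompactSpace E] [SigmaCompactSpace E] [MeasurableSpace E] [BorelSpace E]
    (L : ℕ → C_c(E, ℝ) →ₗ[ℝ] ℝ) (hpos : ∀ k f, 0 ≤ f → 0 ≤ L k f) (M : ℝ)
    (hM : ∀ k (f : C_c(E, ℝ)) C, (∀ x, |f x| ≤ C) → |L k f| ≤ C * M) :
    ∃ ν : Measure E, IsFiniteMeasure ν ∧ ∀ f : C_c(E, ℝ),
      Tendsto (fun k => L k f) (hyperfilter ℕ) (𝓝 (∫ x, f x ∂ν)) := by
  have hbd : ∀ f : C_c(E, ℝ), ∃ C, ∀ x, |f x| ≤ C := fun f =>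
    f.continuous.bounded_above_of_compact_support f.hasCompactSupport
  -- The values stay in a compact interval, so the ultrafilter limit exists for every `f` at once,
  -- with no subsequence to extract; linearity and positivity pass to the limit.
  have hlim : ∀ f : C_c(E, ℝ), ∃ a, Tendsto (fun k => L k f) (hyperfilter ℕ) (𝓝 a) := fun f => by
    obtain ⟨C, hC⟩ := hbd f
    have hK : IsCompact (Icc (-(C * M)) (C * M)) := isCompact_Icc
    obtain ⟨a, -, ha⟩ := hK.ultrafilter_le_nhds' ((hyperfilter ℕ).map fun k => L k f)
      (Ultrafilter.mem_map.2 (univ_mem' fun k => abs_le.1 (hM k f C hC)))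
    exact ⟨a, ha⟩
  choose a ha using hlim
  let Λ₀ : C_c(E, ℝ) →ₗ[ℝ] ℝ :=
    { toFun := a
      map_add' := fun f g => tendsto_nhds_unique (ha (f + g))
        (((ha f).add (ha g)).congr fun k => (map_add (L k) f g).symm)
      map_smul' := fun c f => tendsto_nhds_unique (ha (c • f))
        (((ha f).const_smul c).congr fun k => (map_smul (L k) c f).symm) }
  let Λ : C_c(E, ℝ) →ₚ[ℝ] ℝ := PositiveLinearMap.mk₀ Λ₀ fun f hf =>
    ge_of_tendsto' (ha f) fun k => hpos k f hf
  have hΛ : ∀ f, Λ f = a f := fun _ => rfl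
  refine ⟨RealRMK.rieszMeasure Λ, ⟨?_⟩, fun f => ?_⟩
  · have hle : ∀ j, RealRMK.rieszMeasure Λ (compactCovering E j) ≤ ENNReal.ofReal M := fun j => by
      obtain ⟨f, hf1, -, hfc, hf01⟩ := exists_continuous_one_zero_of_isCompact
        (isCompact_compactCovering E j) isClosed_empty (disjoint_empty _)
      refine (RealRMK.rieszMeasure_le_of_eq_one Λ (f := ⟨f, hfc⟩) (fun x => (hf01 x).1)
        (isCompact_compactCovering E j) hf1).trans (ENNReal.ofReal_le_ofReal ?_)
      rw [hΛ]
      refine le_of_tendsto' (ha _) fun k => (le_abs_self _).trans ?_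
      have := hM k ⟨f, hfc⟩ 1 fun x => by
        change |f x| ≤ 1
        rw [abs_of_nonneg (hf01 x).1]
        exact (hf01 x).2
      rwa [one_mul] at this
    rw [← iUnion_compactCovering E, (monotone_nat_of_le_succ fun j =>
      compactCovering_subset E j.le_succ).measure_iUnion]
    exact (iSup_le hle).trans_lt ENNReal.ofReal_lt_top
  · rw [RealRMK.integral_rieszMeasure, hΛ]
    exact ha f

variable {n : ℕ} {u : EuclideanSpace ℝ (Fin n) → ℝ}

lemma continuous_graphAvg (hu : Integrable u) {f : EuclideanSpace ℝ (Fin n) × ℝ → ℝ}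
    (hf : Continuous f) (hfc : HasCompactSupport f) (k : ℕ) : Continuous (graphAvg u k f) :=
  continuous_integral_mul_mollifier_sub (integrable_comp_graph hu hf hfc k) k

lemma abs_graphAvg_le {f : EuclideanSpace ℝ (Fin n) × ℝ → ℝ} {C : ℝ}
    (hC : ∀ p, |f p| ≤ C) (k : ℕ) (y : EuclideanSpace ℝ (Fin n)) : |graphAvg u k f y| ≤ C :=
  abs_integral_mul_mollifier_sub_le (fun _ => hC _) k y

lemma integrable_graphAvg (hu : Integrable u) {f : EuclideanSpace ℝ (Fin n) × ℝ → ℝ}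
    (hf : Continuous f) (hfc : HasCompactSupport f) (k : ℕ)
    (μ : Measure (EuclideanSpace ℝ (Fin n))) [IsFiniteMeasure μ] :
    Integrable (graphAvg u k f) μ := by
  obtain ⟨C, hC⟩ := hf.bounded_above_of_compact_support hfc
  exact Integrable.of_bound (continuous_graphAvg hu hf hfc k).aestronglyMeasurable C
    (Eventually.of_forall (abs_graphAvg_le hC k))

lemma integrable_comp_graph_mul_mollifier (hu : Integrable u)
    {f : EuclideanSpace ℝ (Fin n) × ℝ → ℝ} (hf : Continuous f) (hfc : HasCompactSupport f) (k : ℕ)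
    (y : EuclideanSpace ℝ (Fin n)) :
    Integrable fun x => f (x, mollify u k x) * mollifier n k (x - y) := by
  have := continuous_mollifier (n := n) k
  exact ((continuous_comp_graph hu hf k).mul (by fun_prop)).integrable_of_hasCompactSupport
    (hasCompactSupport_comp_graph hfc _).mul_right

/-- Graph averaging preserves positivity and does not increase sup bounds, so integrating the
averages against `μ` gives functionals bounded by the mass of `μ`. -/
lemma exists_measure_tendsto_graphAvg (hu : Integrable u)
    (μ : Measure (EuclideanSpace ℝ (Fin n))) [IsFiniteMeasure μ] :
    ∃ ν : Measure (EuclideanSpace ℝ (Fin n) × ℝ), IsFiniteMeasure ν ∧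
      ∀ f : EuclideanSpace ℝ (Fin n) × ℝ → ℝ, Continuous f → HasCompactSupport f →
        Tendsto (fun k => ∫ y, graphAvg u k f y ∂μ) (hyperfilter ℕ) (𝓝 (∫ p, f p ∂ν)) := by
  let L : ℕ → C_c(EuclideanSpace ℝ (Fin n) × ℝ, ℝ) →ₗ[ℝ] ℝ := fun k =>
    { toFun := fun f => ∫ y, graphAvg u k f y ∂μ
      map_add' := fun f g => by
        have hf : Continuous f := f.continuous
        have hg : Continuous g := g.continuous
        have hfc : HasCompactSupport f := f.hasCompactSupport
        have hgc : HasCompactSupport g := g.hasCompactSupport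
        rw [← integral_add (integrable_graphAvg hu hf hfc k μ) (integrable_graphAvg hu hg hgc k μ)]
        congr 1
        funext y
        simp only [graphAvg]
        rw [← integral_add (integrable_comp_graph_mul_mollifier hu hf hfc k y)
          (integrable_comp_graph_mul_mollifier hu hg hgc k y)]
        simp [add_mul]
      map_smul' := fun c f => by
        rw [RingHom.id_apply, smul_eq_mul, ← integral_const_mul]
        congr 1
        funext y
        simp only [graphAvg]
        rw [← integral_const_mul]
        simp [mul_assoc] }
  obtain ⟨ν, hν, h⟩ := exists_measure_tendsto_hyperfilter L
    (fun k f hf => integral_nonneg fun y => integral_nonneg fun x =>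
      mul_nonneg (hf _) (mollifier_nonneg k _)) (μ.real univ)
    (fun k f C hC => by
      change ‖∫ y, graphAvg u k f y ∂μ‖ ≤ _
      exact norm_integral_le_of_norm_le_const (Eventually.of_forall (abs_graphAvg_le hC k)))
  exact ⟨ν, hν, fun f hf hfc => h ⟨⟨f, hf⟩, hfc⟩⟩

lemma exists_signedMeasure_tendsto_graphAvg (hu : Integrable u)
    (D : SignedMeasure (EuclideanSpace ℝ (Fin n))) :
    ∃ μ : SignedMeasure (EuclideanSpace ℝ (Fin n) × ℝ),
      ∀ f : EuclideanSpace ℝ (Fin n) × ℝ → ℝ, Continuous f → HasCompactSupport f →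
        Tendsto (fun k => ∫ᵛ y, graphAvg u k f y ∂•D) (hyperfilter ℕ) (𝓝 (∫ᵛ p, f p ∂•μ)) := by
  obtain ⟨ν₁, _, h₁⟩ := exists_measure_tendsto_graphAvg hu D.toJordanDecomposition.posPart
  obtain ⟨ν₂, _, h₂⟩ := exists_measure_tendsto_graphAvg hu D.toJordanDecomposition.negPart
  refine ⟨ν₁.toSignedMeasure - ν₂.toSignedMeasure, fun f hf hfc => ?_⟩
  have hi : ∀ ν : Measure (EuclideanSpace ℝ (Fin n) × ℝ), ∀ _ : IsFiniteMeasure ν,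
      ν.toSignedMeasure.Integrable f := fun ν _ => hf.integrable_of_hasCompactSupport hfc
  rw [VectorMeasure.integral_sub_vectorMeasure (hi ν₁ inferInstance) (hi ν₂ inferInstance),
    integral_toSignedMeasure_lsmul, integral_toSignedMeasure_lsmul]
  refine ((h₁ f hf hfc).sub (h₂ f hf hfc)).congr fun k => ?_
  exact (integral_signedMeasure_eq_sub D (integrable_graphAvg hu hf hfc k _)).symm

end VagueLimit

/-! ### Comparison of total variations. -/

section Mass

variable {n : ℕ} {u : EuclideanSpace ℝ (Fin n) → ℝ}

/-- Limits of graph averages do not increase the total variation. -/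
lemma totalVar_univ_le_of_tendsto_graphAvg (hu : Integrable u) {κ : Type*} [Fintype κ]
    {U : Set (EuclideanSpace ℝ (Fin n) × ℝ)} (hU : IsOpen U)
    {D : κ → SignedMeasure (EuclideanSpace ℝ (Fin n))}
    {μ : κ → SignedMeasure (EuclideanSpace ℝ (Fin n) × ℝ)}
    (hμ : ∀ i A, MeasurableSet A → Disjoint A U → μ i A = 0)
    (h : ∀ i (φ : EuclideanSpace ℝ (Fin n) × ℝ → ℝ), ContDiff ℝ 1 φ → HasCompactSupport φ →
      tsupport φ ⊆ U →
        Tendsto (fun k => ∫ᵛ y, graphAvg u k φ y ∂•(D i)) atTop (𝓝 (∫ᵛ p, φ p ∂•(μ i)))) :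
    totalVar μ univ ≤ totalVar D univ := by
  have key : totalVar μ univ ≤ ENNReal.ofReal ((totalVar D).real univ) := by
    refine totalVar_univ_le_of_forall_integral_le hU hμ fun φ hφ hc ht hφ1 => ?_
    have hφi : ∀ i, ContDiff ℝ 1 fun x => φ x i := fun i => by fun_prop
    have hci : ∀ i, HasCompactSupport fun x => φ x i := fun i =>
      hc.comp_left (g := fun v : EuclideanSpace ℝ κ => v i) rfl
    have hti : ∀ i, tsupport (fun x => φ x i) ⊆ U := fun i =>
      (tsupport_comp_subset (g := fun v : EuclideanSpace ℝ κ => v i) rfl φ).trans ht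
    refine le_of_tendsto' (tendsto_finsetSum Finset.univ fun i _ =>
      h i _ (hφi i) (hci i) (hti i)) fun k => ?_
    let F : EuclideanSpace ℝ (Fin n) → EuclideanSpace ℝ κ := fun y =>
      WithLp.toLp 2 fun i => graphAvg u k (fun p => φ p i) y
    have hF : Continuous F := (PiLp.continuous_toLp 2 _).comp
      (continuous_pi fun i => continuous_graphAvg hu (hφi i).continuous (hci i) k)
    -- All components are averaged with the same probability density, so `F y` is a mean of vectors
    -- of Euclidean norm at most `1`.
    have hF1 : ∀ y, ‖F y‖ ≤ 1 := fun y => by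
      have hm := continuous_mollifier (n := n) k
      have hmc := (contDiff_mollify k hu).continuous
      have hφc := hφ.continuous
      have hint : Integrable fun x => mollifier n k (x - y) • φ (x, mollify u k x) := by
        refine (by fun_prop : Continuous fun x => mollifier n k (x - y) •
          φ (x, mollify u k x)).integrable_of_hasCompactSupport
            ((hasCompactSupport_comp_graph hc (mollify u k)).mono fun x hx h0 => hx ?_)
        change mollifier n k (x - y) • φ (x, mollify u k x) = 0
        rw [show φ (x, mollify u k x) = 0 from h0, smul_zero]
      have hFy : F y = ∫ x, mollifier n k (x - y) • φ (x, mollify u k x) := by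
        ext i
        have := (EuclideanSpace.proj (𝕜 := ℝ) i : EuclideanSpace ℝ κ →L[ℝ] ℝ).integral_comp_comm
          hint
        refine Eq.trans ?_ this
        simp [F, graphAvg, mul_comm]
      rw [hFy, ← integral_mollifier_sub_right (n := n) k y]
      refine norm_integral_le_of_norm_le ((integrable_mollifier k).comp_sub_right y)
        (Eventually.of_forall fun x => ?_)
      rw [norm_smul, Real.norm_of_nonneg (mollifier_nonneg k _)]
      exact mul_le_of_le_one_right (mollifier_nonneg k _) (hφ1 _)
    have := abs_sum_integral_le D hF.aestronglyMeasurable hF1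
    rw [one_mul] at this
    exact (le_abs_self _).trans this
  rwa [ofReal_measureReal] at key

/-- If the projection of a vector measure to `ℝⁿ` is `D` and its mass does not exceed that of `D`,
then the total variations correspond. -/
lemma map_totalVar_eq {κ : Type*} [Fintype κ]
    {D : κ → SignedMeasure (EuclideanSpace ℝ (Fin n))}
    {μ : κ → SignedMeasure (EuclideanSpace ℝ (Fin n) × ℝ)}
    (hmap : ∀ i, (μ i).map Prod.fst = D i) (hle : totalVar μ univ ≤ totalVar D univ) :
    (totalVar μ).map Prod.fst = totalVar D := by
  have h1 : totalVar D ≤ (totalVar μ).map Prod.fst := by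
    have := totalVar_map_le measurable_fst μ
    simpa only [hmap] using this
  symm
  refine Measure.eq_of_le_of_measure_univ_eq h1 (le_antisymm (h1 univ) ?_)
  rwa [Measure.map_apply measurable_fst MeasurableSet.univ, preimage_univ]

end Mass

/-! ### Cutoffs in the vertical variable. -/

section Cutoff

/-- No bound on the derivatives is required: horizontal fields do not differentiate `η k`, and the
vertical derivative is integrated out. -/
lemma exists_cutoff_sequence : ∃ η : ℕ → ℝ → ℝ, (∀ k, ContDiff ℝ ∞ (η k)) ∧
    (∀ k, HasCompactSupport (η k)) ∧ (∀ k t, η k t ∈ Icc (0 : ℝ) 1) ∧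
    ∀ (k : ℕ) t, |t| ≤ (k : ℝ) → η k t = 1 := by
  have h := fun k : ℕ => exists_smooth_bump (isCompact_Icc (a := -(k : ℝ)) (b := k))
    isOpen_univ (subset_univ _)
  choose η h1 h2 _ h3 h4 using h
  exact ⟨η, h1, h2, h3, fun k t ht => h4 k t (abs_le.1 ht)⟩

variable {n : ℕ} {Ω : Set (EuclideanSpace ℝ (Fin n))} {η : ℕ → ℝ → ℝ}
  {ψ : EuclideanSpace ℝ (Fin n) → ℝ}

lemma tsupport_mul_comp_snd_subset (θ : ℝ → ℝ) (hψt : tsupport ψ ⊆ Ω) :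
    tsupport (fun p : EuclideanSpace ℝ (Fin n) × ℝ => ψ p.1 * θ p.2) ⊆ Ω ×ˢ univ := by
  refine (closure_minimal (t := tsupport ψ ×ˢ univ) (fun p hp => ⟨subset_tsupport _ ?_, mem_univ _⟩)
    ((isClosed_tsupport _).prod isClosed_univ)).trans (prod_mono hψt subset_rfl)
  exact left_ne_zero_of_mul hp

lemma hasCompactSupport_mul_comp_snd {θ : ℝ → ℝ} (hψ : HasCompactSupport ψ)
    (hθ : HasCompactSupport θ) :
    HasCompactSupport fun p : EuclideanSpace ℝ (Fin n) × ℝ => ψ p.1 * θ p.2 := by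
  refine HasCompactSupport.of_support_subset_isCompact (hψ.isCompact.prod hθ.isCompact)
    fun p hp => ⟨subset_tsupport _ (left_ne_zero_of_mul hp), subset_tsupport _
      (right_ne_zero_of_mul hp)⟩

lemma tendsto_integral_mul_cutoff (μ : SignedMeasure (EuclideanSpace ℝ (Fin n) × ℝ))
    (hψ : Continuous ψ) (hψc : HasCompactSupport ψ) (hη : ∀ k, Continuous (η k))
    (hη01 : ∀ k t, η k t ∈ Icc (0 : ℝ) 1) (hη1 : ∀ (k : ℕ) t, |t| ≤ (k : ℝ) → η k t = 1) :
    Tendsto (fun k => ∫ᵛ p, ψ p.1 * η k p.2 ∂•μ) atTop (𝓝 (∫ᵛ x, ψ x ∂•(μ.map Prod.fst))) := by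
  obtain ⟨C, hC⟩ := hψ.bounded_above_of_compact_support hψc
  have hcomp : Continuous fun p : EuclideanSpace ℝ (Fin n) × ℝ => ψ p.1 := by fun_prop
  rw [VectorMeasure.integral_map measurable_fst hψ.aestronglyMeasurable
    (Integrable.of_bound (μ := μ.variation) hcomp.aestronglyMeasurable C
      (Eventually.of_forall fun p => hC _))]
  refine VectorMeasure.tendsto_integral_of_dominated_convergence (fun _ => C) (fun k => ?_)
    (integrable_const C) (fun k => Eventually.of_forall fun p => ?_)
    (Eventually.of_forall fun p => ?_)
  · have := hη k
    exact (by fun_prop : Continuous fun p : EuclideanSpace ℝ (Fin n) × ℝ =>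
      ψ p.1 * η k p.2).aestronglyMeasurable
  · rw [norm_mul, Real.norm_of_nonneg (hη01 k _).1]
    exact (mul_le_of_le_one_right (norm_nonneg _) (hη01 k _).2).trans (hC _)
  · refine tendsto_const_nhds.congr' ?_
    obtain ⟨N, hN⟩ := exists_nat_ge |p.2|
    filter_upwards [eventually_ge_atTop N] with k hk
    rw [hη1 k _ (hN.trans (by exact_mod_cast hk)), mul_one]

end Cutoff

/-! ### Projecting the derivative of the subgraph. -/

section Projection

variable {n : ℕ} {Ω : Set (EuclideanSpace ℝ (Fin n))} {u : EuclideanSpace ℝ (Fin n) → ℝ}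
  {μ : SignedMeasure (EuclideanSpace ℝ (Fin n) × ℝ)}

/-- The projection of the derivative of the subgraph along `(X, 0)` is the derivative of `u`
along `X`. -/
lemma hasWeakDeriv_map_fst {X : EuclideanSpace ℝ (Fin n) → EuclideanSpace ℝ (Fin n)}
    (hX : ContDiff ℝ 1 X) (hum : Measurable u) (hu : Integrable u)
    (h : ∀ φ : EuclideanSpace ℝ (Fin n) × ℝ → ℝ, ContDiff ℝ 1 φ → HasCompactSupport φ →
      tsupport φ ⊆ Ω ×ˢ univ → ∫ᵛ p, φ p ∂•μ =
        -∫ x, ∫ t in Iio (u x), (φ (x, t) * divergence X x + fderiv ℝ φ (x, t) (X x, 0))) :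
    HasWeakDeriv X Ω u (μ.map Prod.fst) := by
  intro ψ hψ hψc hψt
  obtain ⟨η, hη, hηc, hη01, hη1⟩ := exists_cutoff_sequence
  have hV : ContDiff ℝ 1 fun y => ψ y • X y := hψ.smul hX
  have hVc : HasCompactSupport fun y => ψ y • X y := hψc.smul_right
  have hd := continuous_divergence hV
  have hdc := hasCompactSupport_divergence hVc
  have hηi : ∀ k, Integrable (η k) := fun k =>
    (hη k).continuous.integrable_of_hasCompactSupport (hηc k)
  have hη1' : ∀ k t, |η k t| ≤ 1 := fun k t => by
    rw [abs_of_nonneg (hη01 k t).1]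
    exact (hη01 k t).2
  obtain ⟨C, hC⟩ := hd.bounded_above_of_compact_support hdc
  refine tendsto_nhds_unique (tendsto_integral_mul_cutoff μ hψ.continuous hψc
    (fun k => (hη k).continuous) hη01 hη1) ?_
  rw [setIntegral_eq_integral_of_forall_compl_eq_zero fun x hx => by
    rw [image_eq_zero_of_notMem_tsupport fun h => hx (hψt
      (tsupport_smul_subset_left ψ X (tsupport_divergence_subset _ h))), mul_zero]]
  have hpt : ∀ k x, (∫ t in Iio (u x), (ψ x * η k t * divergence X x +
      fderiv ℝ (fun p : EuclideanSpace ℝ (Fin n) × ℝ => ψ p.1 * η k p.2) (x, t) (X x, 0))) =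
      (∫ t in Iio (u x), η k t) * divergence (fun y => ψ y • X y) x := fun k x => by
    rw [← integral_mul_const]
    congr 1
    funext t
    have h1 : HasFDerivAt (fun p : EuclideanSpace ℝ (Fin n) × ℝ => ψ p.1)
        ((fderiv ℝ ψ x).comp (ContinuousLinearMap.fst ℝ _ ℝ)) (x, t) :=
      (hψ.differentiable one_ne_zero x).hasFDerivAt.comp (x, t) hasFDerivAt_fst
    have h2 : HasFDerivAt (fun p : EuclideanSpace ℝ (Fin n) × ℝ => η k p.2)
        ((fderiv ℝ (η k) t).comp (ContinuousLinearMap.snd ℝ _ ℝ)) (x, t) :=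
      ((hη k).differentiable (by simp) t).hasFDerivAt.comp (x, t) hasFDerivAt_snd
    rw [divergence_smul (hψ.differentiable one_ne_zero x) (hX.differentiable one_ne_zero x),
      (h1.fun_mul h2).fderiv]
    simp
    ring
  -- The integral of `η k` up to `u x` diverges with `k`; subtracting the part up to `0` leaves a
  -- quantity that tends to `u x` and is bounded by `|u x|`. The subtracted constant multiplies the
  -- integral of a divergence, which vanishes.
  have hlim : Tendsto (fun k => -∫ x, ((∫ t in Iio (u x), η k t) - ∫ t in Iio 0, η k t) *
      divergence (fun y => ψ y • X y) x) atTop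
      (𝓝 (-∫ x, u x * divergence (fun y => ψ y • X y) x)) := by
    refine (tendsto_integral_of_dominated_convergence (fun x => |u x| * C) (fun k => ?_)
      (hu.abs.mul_const C) (fun k => Eventually.of_forall fun x => ?_)
      (Eventually.of_forall fun x => Tendsto.mul_const _ ?_)).neg
    · refine AEStronglyMeasurable.mul ?_ hd.aestronglyMeasurable
      have hcont : Continuous fun s : ℝ => (∫ t in Iio s, η k t) - ∫ t in Iio 0, η k t := by
        simp_rw [fun s : ℝ => intervalIntegral.integral_Iio_sub_Iio' (a := 0) (b := s)
          (hηi k).integrableOn (hηi k).integrableOn]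
        exact intervalIntegral.continuous_primitive (fun a b => (hηi k).intervalIntegrable) 0
      exact (hcont.measurable.comp hum).aestronglyMeasurable
    · rw [norm_mul, Real.norm_eq_abs]
      refine mul_le_mul ?_ (hC x) (norm_nonneg _) (abs_nonneg _)
      have := abs_setIntegral_Iio_sub_le (hηi k) (hη1' k) (u x) 0
      rwa [one_mul, sub_zero] at this
    · refine tendsto_const_nhds.congr' ?_
      obtain ⟨N, hN⟩ := exists_nat_ge |u x|
      filter_upwards [eventually_ge_atTop N] with k hk
      rw [intervalIntegral.integral_Iio_sub_Iio' (hηi k).integrableOn (hηi k).integrableOn,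
        intervalIntegral.integral_congr (g := fun _ => (1 : ℝ))]
      · simp
      · intro t ht
        refine hη1 k t (le_trans ?_ (hN.trans (by exact_mod_cast hk)))
        have := abs_sub_left_of_mem_uIcc ht
        simpa using this
  refine hlim.congr fun k => ?_
  rw [h _ (by have := (hη k).of_le (m := 1) (by simp); fun_prop)
    (hasCompactSupport_mul_comp_snd hψc (hηc k)) (tsupport_mul_comp_snd_subset _ hψt)]
  congr 1
  simp_rw [hpt, sub_mul]
  have hi1 : Integrable fun x => (∫ t in Iio 0, η k t) * divergence (fun y => ψ y • X y) x :=
    (hd.integrable_of_hasCompactSupport hdc).const_mul _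
  have hi2 : Integrable fun x =>
      (∫ t in Iio (u x), η k t) * divergence (fun y => ψ y • X y) x := by
    have hG : Integrable fun p : EuclideanSpace ℝ (Fin n) × ℝ =>
        divergence (fun y => ψ y • X y) p.1 * η k p.2 :=
      (hd.integrable_of_hasCompactSupport hdc).mul_prod (hηi k)
    refine (integrable_setIntegral_Iio hum hG).congr (Eventually.of_forall fun x => ?_)
    simp only
    rw [integral_const_mul, mul_comm]
  rw [integral_sub hi2 hi1, integral_const_mul, integral_divergence_eq_zero volume hV hVc, mul_zero,
    sub_zero]

/-- The projection of the vertical derivative of the subgraph is `-𝓛ⁿ`. -/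
lemma integral_map_fst_of_vertical (hum : Measurable u)
    (h : ∀ φ : EuclideanSpace ℝ (Fin n) × ℝ → ℝ, ContDiff ℝ 1 φ → HasCompactSupport φ →
      tsupport φ ⊆ Ω ×ˢ univ → ∫ᵛ p, φ p ∂•μ =
        -∫ x, ∫ t in Iio (u x), fderiv ℝ φ (x, t) (0, 1))
    {ψ : EuclideanSpace ℝ (Fin n) → ℝ} (hψ : ContDiff ℝ 1 ψ) (hψc : HasCompactSupport ψ)
    (hψt : tsupport ψ ⊆ Ω) : ∫ᵛ x, ψ x ∂•(μ.map Prod.fst) = -∫ x, ψ x := by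
  obtain ⟨η, hη, hηc, hη01, hη1⟩ := exists_cutoff_sequence
  refine tendsto_nhds_unique (tendsto_integral_mul_cutoff μ hψ.continuous hψc
    (fun k => (hη k).continuous) hη01 hη1) ?_
  have hlim : Tendsto (fun k => -∫ x, ψ x * η k (u x)) atTop (𝓝 (-∫ x, ψ x)) := by
    refine (tendsto_integral_of_dominated_convergence (fun x => |ψ x|) (fun k => ?_)
      (hψ.continuous.integrable_of_hasCompactSupport hψc).abs
      (fun k => Eventually.of_forall fun x => ?_) (Eventually.of_forall fun x => ?_)).neg
    · exact hψ.continuous.aestronglyMeasurable.mul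
        ((hη k).continuous.measurable.comp hum).aestronglyMeasurable
    · rw [norm_mul, Real.norm_of_nonneg (hη01 k _).1]
      exact mul_le_of_le_one_right (norm_nonneg _) (hη01 k _).2
    · refine tendsto_const_nhds.congr' ?_
      obtain ⟨N, hN⟩ := exists_nat_ge |u x|
      filter_upwards [eventually_ge_atTop N] with k hk
      rw [hη1 k _ (hN.trans (by exact_mod_cast hk)), mul_one]
  refine hlim.congr fun k => ?_
  have hsm : ContDiff ℝ 1 fun p : EuclideanSpace ℝ (Fin n) × ℝ => ψ p.1 * η k p.2 := by
    have := (hη k).of_le (m := 1) (by simp)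
    fun_prop
  have hcs := hasCompactSupport_mul_comp_snd hψc (hηc k)
  rw [h _ hsm hcs (tsupport_mul_comp_snd_subset _ hψt)]
  simp_rw [integral_Iio_fderiv_vertical hsm hcs]

end Projection

/-! ### Independence of the field off `Ω` and of null sets. -/

section Congruence

variable {E : Type*} [NormedAddCommGroup E] [NormedSpace ℝ E] [MeasureSpace E] {Ω : Set E}

lemma HasWeakDeriv.congr_field {Y Z : E → E} {u : E → ℝ} {μ : SignedMeasure E}
    (h : HasWeakDeriv Y Ω u μ) (hYZ : EqOn Y Z Ω) : HasWeakDeriv Z Ω u μ := by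
  intro ψ hψ hc ht
  rw [h ψ hψ hc ht]
  have : (fun y => ψ y • Y y) = fun y => ψ y • Z y := by
    funext y
    by_cases hy : y ∈ Ω
    · rw [hYZ hy]
    · rw [image_eq_zero_of_notMem_tsupport fun h' => hy (ht h'), zero_smul, zero_smul]
  rw [this]

lemma isHDeriv_congr_ae {ι : Type*} [Fintype ι] {X : ι → E → E} {u v : E → ℝ}
    (h : u =ᵐ[volume.restrict Ω] v) (D : ι → SignedMeasure E) :
    IsHDeriv X Ω u D ↔ IsHDeriv X Ω v D := by
  have key : ∀ {u v : E → ℝ}, u =ᵐ[volume.restrict Ω] v → IsHDeriv X Ω u D →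
      IsHDeriv X Ω v D := fun {u v} h hD =>
    ⟨hD.concentrated, hD.finite_variation, fun φ hφ hc ht => by
      rw [hD.integral_eq φ hφ hc ht]
      exact congrArg Neg.neg (integral_congr_ae (h.mul (ae_eq_refl (divX X φ))))⟩
  exact ⟨key h, key h.symm⟩

end Congruence

/-! ### Lifting derivatives from `Ω` to the cylinder. -/

section Subgraph

variable {n : ℕ} {Ω : Set (EuclideanSpace ℝ (Fin n))} {u : EuclideanSpace ℝ (Fin n) → ℝ}
  {X : EuclideanSpace ℝ (Fin n) → EuclideanSpace ℝ (Fin n)}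
  {D : SignedMeasure (EuclideanSpace ℝ (Fin n))}
  {μ : SignedMeasure (EuclideanSpace ℝ (Fin n) × ℝ)}

/-- Mollification and Fubini want a Borel function that is integrable on the whole space; the change
affects `u` and its subgraph only on null sets. -/
lemma exists_measurable_representative (hΩ : MeasurableSet Ω) (hu : IntegrableOn u Ω) :
    ∃ v : EuclideanSpace ℝ (Fin n) → ℝ, Measurable v ∧ Integrable v ∧ (∀ x ∉ Ω, v x = 0) ∧
      u =ᵐ[volume.restrict Ω] v := by
  obtain ⟨w, hw, huw⟩ := hu.aestronglyMeasurable
  have h : u =ᵐ[volume.restrict Ω] Ω.indicator w :=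
    huw.trans (indicator_ae_eq_restrict hΩ).symm
  refine ⟨Ω.indicator w, hw.measurable.indicator hΩ, ?_, fun x hx => indicator_of_notMem hx _, h⟩
  rw [integrable_indicator_iff hΩ]
  exact hu.congr huw

lemma indicator_subgraph_ae_eq (hΩ : MeasurableSet Ω) {v : EuclideanSpace ℝ (Fin n) → ℝ}
    (huv : u =ᵐ[volume.restrict Ω] v) (s : Set (EuclideanSpace ℝ (Fin n) × ℝ)) :
    (subgraph Ω u).indicator (fun _ => (1 : ℝ)) =ᵐ[volume.restrict s]
      (subgraph Ω v).indicator fun _ => (1 : ℝ) := by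
  refine ae_restrict_of_ae ?_
  filter_upwards [ae_mem_imp_eq_fst hΩ huv] with p hp
  have h : p ∈ subgraph Ω u ↔ p ∈ subgraph Ω v :=
    and_congr_right fun hpΩ => by rw [hp hpΩ]
  by_cases hpu : p ∈ subgraph Ω u
  · rw [indicator_of_mem hpu, indicator_of_mem (h.1 hpu)]
  · rw [indicator_of_notMem hpu, indicator_of_notMem (h.not.1 hpu)]

/-- Boundedness of `Ω` enters here: cutting `X` off away from the compact closure gives the global
Lipschitz and divergence bounds of the commutator estimate. -/
lemma exists_field_hasCompactSupport (hX : ContDiff ℝ 1 X) (hΩ : Bornology.IsBounded Ω) :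
    ∃ Y : EuclideanSpace ℝ (Fin n) → EuclideanSpace ℝ (Fin n),
      ContDiff ℝ 1 Y ∧ HasCompactSupport Y ∧ EqOn X Y Ω := by
  obtain ⟨χ, hχ, hχc, -, -, hχ1⟩ := exists_smooth_bump hΩ.isCompact_closure isOpen_univ
    (subset_univ _)
  refine ⟨fun x => χ x • X x, (hχ.of_le (by simp)).smul hX, hχc.smul_right, fun x hx => ?_⟩
  simp only
  rw [hχ1 x (subset_closure hx), one_smul]

lemma hasWeakDeriv_lift_iff (hX : ContDiff ℝ 1 X) (hΩ : MeasurableSet Ω) (hu : Measurable u) :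
    HasWeakDeriv (fun p : EuclideanSpace ℝ (Fin n) × ℝ => (X p.1, (0 : ℝ))) (Ω ×ˢ univ)
        ((subgraph Ω u).indicator fun _ => 1) μ ↔
      ∀ φ : EuclideanSpace ℝ (Fin n) × ℝ → ℝ, ContDiff ℝ 1 φ → HasCompactSupport φ →
        tsupport φ ⊆ Ω ×ˢ univ → ∫ᵛ p, φ p ∂•μ =
          -∫ x, ∫ t in Iio (u x), (φ (x, t) * divergence X x + fderiv ℝ φ (x, t) (X x, 0)) := by
  refine forall_congr' fun φ => forall₃_congr fun hφ hc ht => ?_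
  have hV : ContDiff ℝ 1 fun p : EuclideanSpace ℝ (Fin n) × ℝ => φ p • (X p.1, (0 : ℝ)) := by
    fun_prop
  rw [integral_indicator_subgraph_mul hΩ hu ae_eq_rfl
    ((continuous_divergence hV).integrable_of_hasCompactSupport
      (hasCompactSupport_divergence hc.smul_right)) fun p hp =>
        image_eq_zero_of_notMem_tsupport fun h => hp (ht (tsupport_smul_subset_left φ _
          (tsupport_divergence_subset _ h))).1]
  simp_rw [divergence_smul_lift (hφ.differentiable one_ne_zero _)
    (hX.differentiable one_ne_zero _)]

lemma hasWeakDeriv_vertical_iff (hΩ : MeasurableSet Ω) (hu : Measurable u) :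
    HasWeakDeriv (fun _ : EuclideanSpace ℝ (Fin n) × ℝ => (0, (1 : ℝ))) (Ω ×ˢ univ)
        ((subgraph Ω u).indicator fun _ => 1) μ ↔
      ∀ φ : EuclideanSpace ℝ (Fin n) × ℝ → ℝ, ContDiff ℝ 1 φ → HasCompactSupport φ →
        tsupport φ ⊆ Ω ×ˢ univ → ∫ᵛ p, φ p ∂•μ =
          -∫ x, ∫ t in Iio (u x), fderiv ℝ φ (x, t) (0, 1) := by
  refine forall_congr' fun φ => forall₃_congr fun hφ hc ht => ?_
  have hV : ContDiff ℝ 1 fun p : EuclideanSpace ℝ (Fin n) × ℝ =>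
      φ p • ((0, 1) : EuclideanSpace ℝ (Fin n) × ℝ) := by
    fun_prop
  rw [integral_indicator_subgraph_mul hΩ hu ae_eq_rfl
    ((continuous_divergence hV).integrable_of_hasCompactSupport
      (hasCompactSupport_divergence hc.smul_right)) fun p hp =>
        image_eq_zero_of_notMem_tsupport fun h => hp (ht (tsupport_smul_subset_left φ _
          (tsupport_divergence_subset _ h))).1]
  simp_rw [divergence_smul_vertical (hφ.differentiable one_ne_zero _)]

lemma exists_concentrated_of_tendsto_graphAvg (hΩ : MeasurableSet Ω) (hu : Integrable u)
    {Λ : (EuclideanSpace ℝ (Fin n) × ℝ → ℝ) → ℝ}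
    (h : ∀ φ : EuclideanSpace ℝ (Fin n) × ℝ → ℝ, ContDiff ℝ 1 φ → HasCompactSupport φ →
      tsupport φ ⊆ Ω ×ˢ univ →
        Tendsto (fun k => ∫ᵛ y, graphAvg u k φ y ∂•D) atTop (𝓝 (Λ φ))) :
    ∃ μ : SignedMeasure (EuclideanSpace ℝ (Fin n) × ℝ),
      (∀ A, MeasurableSet A → Disjoint A (Ω ×ˢ univ) → μ A = 0) ∧
      ∀ φ : EuclideanSpace ℝ (Fin n) × ℝ → ℝ, ContDiff ℝ 1 φ → HasCompactSupport φ →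
        tsupport φ ⊆ Ω ×ˢ univ → ∫ᵛ p, φ p ∂•μ = Λ φ := by
  obtain ⟨μ, hμ⟩ := exists_signedMeasure_tendsto_graphAvg hu D
  have hm : MeasurableSet (Ω ×ˢ (univ : Set ℝ)) := hΩ.prod MeasurableSet.univ
  -- The ultrafilter limit may charge sets outside the cylinder. Restricting it does not affect
  -- admissible test functions, for which the limit along the ultrafilter is the ordinary one.
  refine ⟨μ.restrict (Ω ×ˢ univ), fun A hA hd => ?_, fun φ hφ hc ht => ?_⟩
  · rw [VectorMeasure.restrict_apply _ hm hA, hd.inter_eq, VectorMeasure.empty]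
  · rw [VectorMeasure.setIntegral_eq_integral_of_forall_compl_eq_zero hm fun p hp =>
      image_eq_zero_of_notMem_tsupport fun h' => hp (ht h')]
    exact tendsto_nhds_unique (hμ φ hφ.continuous hc)
      ((h φ hφ hc ht).mono_left Nat.hyperfilter_le_atTop)

lemma tendsto_integral_graphAvg_of_isBounded (hX : ContDiff ℝ 1 X) (hΩ : IsOpen Ω)
    (hΩb : Bornology.IsBounded Ω) (hum : Measurable u) (hu : Integrable u)
    (hu0 : ∀ x ∉ Ω, u x = 0) (hD : HasWeakDeriv X Ω u D) :
    ∃ Y, ContDiff ℝ 1 Y ∧ EqOn X Y Ω ∧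
      ∀ φ : EuclideanSpace ℝ (Fin n) × ℝ → ℝ, ContDiff ℝ 1 φ → HasCompactSupport φ →
        tsupport φ ⊆ Ω ×ˢ univ → Tendsto (fun k => ∫ᵛ y, graphAvg u k φ y ∂•D) atTop
          (𝓝 (-∫ x, ∫ t in Iio (u x),
            (φ (x, t) * divergence Y x + fderiv ℝ φ (x, t) (Y x, 0)))) := by
  obtain ⟨Y, hY, hYc, hXY⟩ := exists_field_hasCompactSupport hX hΩb
  exact ⟨Y, hY, hXY, fun φ hφ hc ht => tendsto_integral_graphAvg hY hYc hΩ hum hu hu0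
    (hD.congr_field hXY) hφ hc ht⟩

lemma lift_eqOn {Y : EuclideanSpace ℝ (Fin n) → EuclideanSpace ℝ (Fin n)} (h : EqOn X Y Ω) :
    EqOn (fun p : EuclideanSpace ℝ (Fin n) × ℝ => (X p.1, (0 : ℝ))) (fun p => (Y p.1, 0))
      (Ω ×ˢ univ) := fun p hp => by
  simp only
  rw [h hp.1]

/-- If `u` has a derivative along `X`, then its subgraph has a derivative along `(X, 0)`. -/
lemma exists_hasWeakDeriv_lift (hX : ContDiff ℝ 1 X) (hΩ : IsOpen Ω)
    (hΩb : Bornology.IsBounded Ω) (hum : Measurable u) (hu : Integrable u)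
    (hu0 : ∀ x ∉ Ω, u x = 0) (hD : HasWeakDeriv X Ω u D) :
    ∃ μ : SignedMeasure (EuclideanSpace ℝ (Fin n) × ℝ),
      (∀ A, MeasurableSet A → Disjoint A (Ω ×ˢ univ) → μ A = 0) ∧
      HasWeakDeriv (fun p : EuclideanSpace ℝ (Fin n) × ℝ => (X p.1, (0 : ℝ))) (Ω ×ˢ univ)
        ((subgraph Ω u).indicator fun _ => 1) μ := by
  obtain ⟨Y, hY, hXY, h⟩ := tendsto_integral_graphAvg_of_isBounded hX hΩ hΩb hum hu hu0 hD
  obtain ⟨μ, hμ, hμφ⟩ := exists_concentrated_of_tendsto_graphAvg hΩ.measurableSet hu h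
  exact ⟨μ, hμ, ((hasWeakDeriv_lift_iff hY hΩ.measurableSet hum).2 hμφ).congr_field
    (lift_eqOn hXY).symm⟩

lemma exists_hasWeakDeriv_vertical (hΩ : IsOpen Ω) (hΩb : Bornology.IsBounded Ω)
    (hum : Measurable u) (hu : Integrable u) :
    ∃ μ : SignedMeasure (EuclideanSpace ℝ (Fin n) × ℝ),
      (∀ A, MeasurableSet A → Disjoint A (Ω ×ˢ univ) → μ A = 0) ∧
      HasWeakDeriv (fun _ : EuclideanSpace ℝ (Fin n) × ℝ => (0, (1 : ℝ))) (Ω ×ˢ univ)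
        ((subgraph Ω u).indicator fun _ => 1) μ := by
  obtain ⟨μ, hμ, hμφ⟩ := exists_concentrated_of_tendsto_graphAvg hΩ.measurableSet hu
    fun φ hφ hc ht => tendsto_integral_graphAvg_vertical hΩ hΩb hum hu hφ hc ht
  exact ⟨μ, hμ, (hasWeakDeriv_vertical_iff hΩ.measurableSet hum).2 hμφ⟩

lemma tendsto_graphAvg_of_hasWeakDeriv_lift (hX : ContDiff ℝ 1 X) (hΩ : IsOpen Ω)
    (hΩb : Bornology.IsBounded Ω) (hum : Measurable u) (hu : Integrable u)
    (hu0 : ∀ x ∉ Ω, u x = 0) (hD : HasWeakDeriv X Ω u D)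
    (hμ : HasWeakDeriv (fun p : EuclideanSpace ℝ (Fin n) × ℝ => (X p.1, (0 : ℝ))) (Ω ×ˢ univ)
      ((subgraph Ω u).indicator fun _ => 1) μ)
    {φ : EuclideanSpace ℝ (Fin n) × ℝ → ℝ} (hφ : ContDiff ℝ 1 φ) (hc : HasCompactSupport φ)
    (ht : tsupport φ ⊆ Ω ×ˢ univ) :
    Tendsto (fun k => ∫ᵛ y, graphAvg u k φ y ∂•D) atTop (𝓝 (∫ᵛ p, φ p ∂•μ)) := by
  obtain ⟨Y, hY, hXY, h⟩ := tendsto_integral_graphAvg_of_isBounded hX hΩ hΩb hum hu hu0 hD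
  rw [(hasWeakDeriv_lift_iff hY hΩ.measurableSet hum).1 (hμ.congr_field (lift_eqOn hXY)) φ hφ hc ht]
  exact h φ hφ hc ht

lemma tendsto_graphAvg_of_hasWeakDeriv_vertical (hΩ : IsOpen Ω)
    (hΩb : Bornology.IsBounded Ω) (hum : Measurable u) (hu : Integrable u)
    (hμ : HasWeakDeriv (fun _ : EuclideanSpace ℝ (Fin n) × ℝ => (0, (1 : ℝ))) (Ω ×ˢ univ)
      ((subgraph Ω u).indicator fun _ => 1) μ)
    {φ : EuclideanSpace ℝ (Fin n) × ℝ → ℝ} (hφ : ContDiff ℝ 1 φ) (hc : HasCompactSupport φ)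
    (ht : tsupport φ ⊆ Ω ×ˢ univ) :
    Tendsto (fun k => ∫ᵛ y, graphAvg u k φ y ∂•(-lebesgueSigned Ω hΩb)) atTop
      (𝓝 (∫ᵛ p, φ p ∂•μ)) := by
  rw [(hasWeakDeriv_vertical_iff hΩ.measurableSet hum).1 hμ φ hφ hc ht]
  exact tendsto_integral_graphAvg_vertical hΩ hΩb hum hu hφ hc ht

lemma map_fst_eq_zero_of_disjoint
    (h : ∀ A, MeasurableSet A → Disjoint A (Ω ×ˢ univ) → μ A = 0)
    {A : Set (EuclideanSpace ℝ (Fin n))} (hA : MeasurableSet A) (hd : Disjoint A Ω) :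
    μ.map Prod.fst A = 0 := by
  rw [VectorMeasure.map_apply _ measurable_fst hA]
  exact h _ (measurable_fst hA) (disjoint_left.2 fun p hp hp' => disjoint_left.1 hd hp hp'.1)

lemma lebesgueSigned_eq_zero_of_disjoint (hΩb : Bornology.IsBounded Ω)
    {A : Set (EuclideanSpace ℝ (Fin n))} (hA : MeasurableSet A) (hd : Disjoint A Ω) :
    lebesgueSigned Ω hΩb A = 0 := by
  have : IsFiniteMeasure (volume.restrict Ω) := ⟨by simpa using hΩb.measure_lt_top⟩
  rw [lebesgueSigned, Measure.toSignedMeasure_apply_measurable hA, measureReal_restrict_apply hA,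
    hd.inter_eq, measureReal_empty]

lemma integral_neg_lebesgueSigned (hΩb : Bornology.IsBounded Ω)
    {ψ : EuclideanSpace ℝ (Fin n) → ℝ} (hψ : tsupport ψ ⊆ Ω) :
    ∫ᵛ x, ψ x ∂•(-lebesgueSigned Ω hΩb) = -∫ x, ψ x := by
  have : IsFiniteMeasure (volume.restrict Ω) := ⟨by simpa using hΩb.measure_lt_top⟩
  rw [VectorMeasure.integral_neg_vectorMeasure, lebesgueSigned, integral_toSignedMeasure_lsmul,
    setIntegral_eq_integral_of_forall_compl_eq_zero fun x hx =>
      image_eq_zero_of_notMem_tsupport fun h => hx (hψ h)]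

lemma variation_neg_lebesgueSigned (hΩb : Bornology.IsBounded Ω) :
    (-lebesgueSigned Ω hΩb).variation = volume.restrict Ω := by
  have : IsFiniteMeasure (volume.restrict Ω) := ⟨by simpa using hΩb.measure_lt_top⟩
  rw [VectorMeasure.variation_neg, lebesgueSigned, Measure.variation_toSignedMeasure]

end Subgraph

/-! ### The full family of fields: equivalence and identities of measures. -/

section Extend

variable {n m : ℕ} {X : Fin m → EuclideanSpace ℝ (Fin n) → EuclideanSpace ℝ (Fin n)}
  {Ω : Set (EuclideanSpace ℝ (Fin n))} {u : EuclideanSpace ℝ (Fin n) → ℝ}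

@[simp]
lemma extend_castSucc (i : Fin m) : extend X i.castSucc = fun p => (X i p.1, 0) :=
  Fin.snoc_castSucc ..

@[simp]
lemma extend_last : extend X (Fin.last m) = fun _ => (0, 1) :=
  Fin.snoc_last ..

@[simp]
lemma appendNegLebesgue_castSucc (hΩb : Bornology.IsBounded Ω)
    (D : Fin m → SignedMeasure (EuclideanSpace ℝ (Fin n))) (i : Fin m) :
    appendNegLebesgue Ω hΩb D i.castSucc = D i :=
  Fin.snoc_castSucc ..

@[simp]
lemma appendNegLebesgue_last (hΩb : Bornology.IsBounded Ω)
    (D : Fin m → SignedMeasure (EuclideanSpace ℝ (Fin n))) :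
    appendNegLebesgue Ω hΩb D (Fin.last m) = -lebesgueSigned Ω hΩb :=
  Fin.snoc_last ..

lemma contDiff_extend (hX : ∀ i, ContDiff ℝ 1 (X i)) (j : Fin (m + 1)) :
    ContDiff ℝ 1 (extend X j) := by
  refine Fin.lastCases ?_ (fun i => ?_) j
  · rw [extend_last]
    exact contDiff_const
  · rw [extend_castSucc]
    have := hX i
    fun_prop

lemma isHDeriv_extend_iff (hX : ∀ i, ContDiff ℝ 1 (X i)) (hΩ : IsOpen Ω) (hum : Measurable u)
    {Dχ : Fin (m + 1) → SignedMeasure (EuclideanSpace ℝ (Fin n) × ℝ)} :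
    IsHDeriv (extend X) (Ω ×ˢ univ) ((subgraph Ω u).indicator fun _ => (1 : ℝ)) Dχ ↔
      (∀ j A, MeasurableSet A → Disjoint A (Ω ×ˢ univ) → Dχ j A = 0) ∧
      (∀ i : Fin m, HasWeakDeriv (fun p : EuclideanSpace ℝ (Fin n) × ℝ => (X i p.1, (0 : ℝ)))
        (Ω ×ˢ univ) ((subgraph Ω u).indicator fun _ => 1) (Dχ i.castSucc)) ∧
      HasWeakDeriv (fun _ : EuclideanSpace ℝ (Fin n) × ℝ => (0, (1 : ℝ)))
        (Ω ×ˢ univ) ((subgraph Ω u).indicator fun _ => 1) (Dχ (Fin.last m)) := by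
  rw [isHDeriv_iff (contDiff_extend hX) (hΩ.prod isOpen_univ)
    (locallyIntegrableOn_indicator_subgraph hΩ.measurableSet hum ae_eq_rfl _)]
  refine and_congr_right fun _ => ⟨fun h => ⟨fun i => ?_, ?_⟩, fun h j => ?_⟩
  · simpa using h i.castSucc
  · simpa using h (Fin.last m)
  · refine Fin.lastCases ?_ (fun i => ?_) j
    · simpa using h.2
    · simpa using h.1 i

lemma memBVH_iff_hasFiniteHPerimeter (hX : ∀ i, ContDiff ℝ 1 (X i)) (hΩ : IsOpen Ω)
    (hΩb : Bornology.IsBounded Ω) (hu : IntegrableOn u Ω) :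
    MemBVH X Ω u ↔ HasFiniteHPerimeter (extend X) (Ω ×ˢ univ) (subgraph Ω u) := by
  obtain ⟨v, hvm, hv, hv0, huv⟩ := exists_measurable_representative hΩ.measurableSet hu
  have hsub : subgraph Ω u ⊆ Ω ×ˢ univ := fun p hp => ⟨hp.1, mem_univ _⟩
  have hloc := locallyIntegrableOn_indicator_subgraph hΩ.measurableSet hvm huv
    (Ω ×ˢ (univ : Set ℝ))
  simp only [MemBVH, HasFiniteHPerimeter, hu, hsub, hloc, true_and, isHDeriv_congr_ae huv,
    isHDeriv_congr_ae (indicator_subgraph_ae_eq hΩ.measurableSet huv (Ω ×ˢ univ)),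
    isHDeriv_extend_iff hX hΩ hvm, isHDeriv_iff hX hΩ hv.integrableOn.locallyIntegrableOn]
  constructor
  · rintro ⟨D, -, hD⟩
    choose μ hμ hμD using fun i =>
      exists_hasWeakDeriv_lift (hX i) hΩ hΩb hvm hv hv0 (hD i)
    obtain ⟨ν, hν, hνD⟩ := exists_hasWeakDeriv_vertical hΩ hΩb hvm hv
    refine ⟨Fin.snoc (α := fun _ => SignedMeasure (EuclideanSpace ℝ (Fin n) × ℝ)) μ ν,
      fun j => ?_, fun i => ?_, ?_⟩
    · refine Fin.lastCases ?_ (fun i => ?_) j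
      · rwa [Fin.snoc_last]
      · rw [Fin.snoc_castSucc]
        exact hμ i
    · rw [Fin.snoc_castSucc]
      exact hμD i
    · rwa [Fin.snoc_last]
  · rintro ⟨Dχ, h0, h1, -⟩
    exact ⟨fun i => (Dχ i.castSucc).map Prod.fst,
      fun i A hA hd => map_fst_eq_zero_of_disjoint (h0 i.castSucc) hA hd,
      fun i => hasWeakDeriv_map_fst (hX i) hvm hv
        ((hasWeakDeriv_lift_iff (hX i) hΩ.measurableSet hvm).1 (h1 i))⟩

/-- The comparison works for any subfamily `e` of components because one averaging operator serves
them all; this form contains every total variation identity of the theorem. -/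
lemma map_fst_totalVar_eq (hX : ∀ i, ContDiff ℝ 1 (X i)) (hΩ : IsOpen Ω)
    (hΩb : Bornology.IsBounded Ω) (hu : IntegrableOn u Ω)
    {Du : Fin m → SignedMeasure (EuclideanSpace ℝ (Fin n))}
    {Dχ : Fin (m + 1) → SignedMeasure (EuclideanSpace ℝ (Fin n) × ℝ)}
    (hD : IsHDeriv X Ω u Du)
    (hχ : IsHDeriv (extend X) (Ω ×ˢ univ) ((subgraph Ω u).indicator fun _ => (1 : ℝ)) Dχ) :
    (∀ j, (Dχ j).map Prod.fst = appendNegLebesgue Ω hΩb Du j) ∧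
      ∀ (κ : Type) (_ : Fintype κ) (e : κ → Fin (m + 1)),
        (totalVar fun i => Dχ (e i)).map Prod.fst =
          totalVar fun i => appendNegLebesgue Ω hΩb Du (e i) := by
  obtain ⟨v, hvm, hv, hv0, huv⟩ := exists_measurable_representative hΩ.measurableSet hu
  rw [isHDeriv_congr_ae huv, isHDeriv_iff hX hΩ hv.integrableOn.locallyIntegrableOn] at hD
  rw [isHDeriv_congr_ae (indicator_subgraph_ae_eq hΩ.measurableSet huv (Ω ×ˢ univ)),
    isHDeriv_extend_iff hX hΩ hvm] at hχ
  obtain ⟨hD0, hD⟩ := hD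
  obtain ⟨h0, h1, h2⟩ := hχ
  have hmap : ∀ j, (Dχ j).map Prod.fst = appendNegLebesgue Ω hΩb Du j := fun j => by
    refine Fin.lastCases ?_ (fun i => ?_) j
    · rw [appendNegLebesgue_last]
      refine eq_of_forall_integral_eq hΩ
        (fun A hA hd => map_fst_eq_zero_of_disjoint (h0 _) hA hd) (fun A hA hd => ?_)
        fun ψ hψ hc ht => ?_
      · simp [lebesgueSigned_eq_zero_of_disjoint hΩb hA hd]
      · rw [integral_map_fst_of_vertical hvm
          ((hasWeakDeriv_vertical_iff hΩ.measurableSet hvm).1 h2) hψ hc ht,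
          integral_neg_lebesgueSigned hΩb ht]
    · rw [appendNegLebesgue_castSucc]
      refine eq_of_forall_integral_eq hΩ
        (fun A hA hd => map_fst_eq_zero_of_disjoint (h0 _) hA hd) (hD0 i) fun ψ hψ hc ht => ?_
      rw [hD i ψ hψ hc ht, hasWeakDeriv_map_fst (hX i) hvm hv
        ((hasWeakDeriv_lift_iff (hX i) hΩ.measurableSet hvm).1 (h1 i)) ψ hψ hc ht]
  refine ⟨hmap, fun κ _ e => map_totalVar_eq (fun i => hmap (e i)) ?_⟩
  refine totalVar_univ_le_of_tendsto_graphAvg hv (hΩ.prod isOpen_univ) (fun i => h0 (e i))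
    fun i φ hφ hc ht => ?_
  generalize e i = j
  refine Fin.lastCases ?_ (fun i => ?_) j
  · rw [appendNegLebesgue_last]
    exact tendsto_graphAvg_of_hasWeakDeriv_vertical hΩ hΩb hvm hv h2 hφ hc ht
  · rw [appendNegLebesgue_castSucc]
    exact tendsto_graphAvg_of_hasWeakDeriv_lift (hX i) hΩ hΩb hvm hv hv0 (hD i) (h1 i) hφ hc ht

end Extend

end HVar

end

theorem theorem4 {n m : ℕ}
    (X : Fin m → EuclideanSpace ℝ (Fin n) → EuclideanSpace ℝ (Fin n))
    (hX : ∀ i, ContDiff ℝ ∞ (X i)) (hXli : LinearIndependent ℝ X)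
    (Ω : Set (EuclideanSpace ℝ (Fin n))) (hΩ : IsOpen Ω) (hΩb : Bornology.IsBounded Ω)
    (u : EuclideanSpace ℝ (Fin n) → ℝ) (hu : IntegrableOn u Ω) :
    (HVar.MemBVH X Ω u ↔
      HVar.HasFiniteHPerimeter (HVar.extend X) (Ω ×ˢ univ) (HVar.subgraph Ω u)) ∧
    ∀ (Du : Fin m → SignedMeasure (EuclideanSpace ℝ (Fin n)))
      (Dχ : Fin (m + 1) → SignedMeasure (EuclideanSpace ℝ (Fin n) × ℝ)),
      HVar.IsHDeriv X Ω u Du →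
      HVar.IsHDeriv (HVar.extend X) (Ω ×ˢ univ)
        ((HVar.subgraph Ω u).indicator fun _ => (1 : ℝ)) Dχ →
      (∀ i : Fin m, (Dχ i.castSucc).map Prod.fst = Du i) ∧
      (Dχ (Fin.last m)).map Prod.fst = -HVar.lebesgueSigned Ω hΩb ∧
      (∀ i : Fin m,
        (Dχ i.castSucc).variation.map Prod.fst = (Du i).variation) ∧
      (Dχ (Fin.last m)).variation.map Prod.fst = volume.restrict Ω ∧
      (HVar.totalVar fun i : Fin m => Dχ i.castSucc).map Prod.fst = HVar.totalVar Du ∧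
      (HVar.totalVar Dχ).map Prod.fst =
        HVar.totalVar (HVar.appendNegLebesgue Ω hΩb Du) := by
  have hX1 : ∀ i, ContDiff ℝ 1 (X i) := fun i => (hX i).of_le (by simp)
  refine ⟨HVar.memBVH_iff_hasFiniteHPerimeter hX1 hΩ hΩb hu, fun Du Dχ hD hχ => ?_⟩
  obtain ⟨h1, h2⟩ := HVar.map_fst_totalVar_eq hX1 hΩ hΩb hu hD hχ
  have h3 : ∀ j, (Dχ j).variation.map Prod.fst =
      (HVar.appendNegLebesgue Ω hΩb Du j).variation := fun j => by
    -- With a single component, the Euclidean total variation is the scalar variation.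
    simpa only [HVar.totalVar_unique] using h2 Unit inferInstance fun _ => j
  refine ⟨fun i => ?_, ?_, fun i => ?_, ?_, ?_, ?_⟩
  · simpa using h1 i.castSucc
  · simpa using h1 (Fin.last m)
  · simpa using h3 i.castSucc
  · rw [h3, HVar.appendNegLebesgue_last, HVar.variation_neg_lebesgueSigned]
  · simpa using h2 (Fin m) inferInstance Fin.castSucc
  · exact h2 (Fin (m + 1)) inferInstance id
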